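/- **Setting.** Let $\mathbb H^3_1=\{(z^1,z^2)\in\mathbb C^2 : |z^1|^2-|z^2|^2=1\}$, identified with $SU(1,1)$ via $(z^1,z^2)\mapsto\begin{pmatrix} z^1&z^2\\ \bar z^2&\bar z^1\end{pmatrix}$, with base point $o=(1,0)$. Let $X_0=\begin{pmatrix} i&0\\0&-i\end{pmatrix}$, $X_1=\begin{pmatrix}0&1\\1&0\end{pmatrix}$, $X_2=\begin{pmatrix}0&i\\-i&0\end{pmatrix}\in\mathfrak{su}(1,1)$, regarded also as left-invariant vector fields on $\mathbb H^3_1$, with dual coframe $\theta^0,\theta^1,\theta^2$. Let $\lambda\in\mathbb R$, $\mu,\nu>0$ with $-\lambda=\nu\neq\mu$, let $t\in\mathbb R$, and put $$g=g_{\lambda\mu\nu}=\lambda\,\theta^0\otimes\theta^0+\mu\,\theta^1\otimes\theta^1+\nu\,\theta^2\otimes\theta^2 .$$ Let $\nabla$ be the Levi-Civita connection of $g$, with curvature tensor $R$, and let $S=S_\mu(t)$ be the tensor field $$S_\mu(t)=\mu\,\theta^2\otimes(\theta^0\wedge\theta^1)+\mu\,\theta^0\otimes(\theta^1\wedge\theta^2)+t\,\theta^1\otimes(\theta^2\wedge\theta^0),\qquad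 \alpha\wedge\beta=\alpha\otimes\beta-\beta\otimes\alpha ,$$ also viewed as a $(1,2)$-tensor field through $S(X,Y,Z)=g(S_XY,Z)$. Put $\widetilde\nabla=\nabla-S$, with curvature $\widetilde R$ (convention $R(X,Y)Z=\nabla_X\nabla_YZ-\nabla_Y\nabla_XZ-\nabla_{[X,Y]}Z$). Let $\bar X_0=X_0/\sqrt{|\lambda|}$, $\bar X_1=X_1/\sqrt\mu$, $\bar X_2=X_2/\sqrt\nu$, with dual coframe $\bar\theta^\alpha$, and $$\tilde\phi_1=-\bar X_2\otimes\bar\theta^0-\bar X_0\otimes\bar\theta^2,\qquad \xi_1=\bar X_1,\qquad \eta_1=\bar\theta^1 .$$ **Theorem.** The metric $g$ is Lorentzian, and the following hold. 1. $(g,\tilde\phi_1,\xi_1,\eta_1)$ is a $\beta$-paraSasakian structure with $\beta=-\frac{\sqrt\mu}{\nu}$. That is, $\tilde\phi_1^2=\mathrm{id}-\eta_1\otimes\xi_1$, $\eta_1(\xi_1)=1$, $g(\tilde\phi_1X,\tilde\phi_1Y)=-g(X,Y)+\eta_1(X)\eta_1(Y)$, and $(\nabla_X\tilde\phi_1)Y=\beta\,(g(X,Y)\xi_1-\eta_1(Y)X)$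 for all vector fields $X,Y$. 2. $(S_\mu(t),\tilde\phi_1,\xi_1,\eta_1)$ is a homogeneous almost paracontact metric structure: $\widetilde\nabla g=0$, $\widetilde\nabla R=0$, $\widetilde\nabla S=0$, $\widetilde\nabla\tilde\phi_1=0$, $\widetilde\nabla\xi_1=0$, $\widetilde\nabla\eta_1=0$. 3. If $t\neq2\nu-\mu$, the group $G=SU(1,1)\times\mathbb R$ acts on $(\mathbb H^3_1,g)$ transitively, effectively and by isometries, preserving also $S_\mu(t),\tilde\phi_1,\xi_1,\eta_1$, via $$\big((A_0,s),Z\big)\mapsto A_0Z\begin{pmatrix}\cosh s&-\sinh s\\-\sinh s&\cosh s\end{pmatrix},$$ and the homogeneous structure $S_\mu(t)$ induces the reductive decomposition $\mathfrak{su}(1,1)\oplus\mathbb R D=\mathfrak h\oplus\mathfrak m$, where $D$ is the generator of the central factor $\mathbb R$, and $$\mathfrak h=\mathrm{span}\{X_1+D\},\qquad \mathfrak m=\mathrm{span}\Big\{X_0,\ \tfrac{\mu+t}{2\nu}X_1-\tfrac{2\nu-\mu-t}{2\nu}D,\ X_2\Big\}.$$ 4. If $t=2\nu-\mu$, the group $G=SU(1,1)$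 acts on $(\mathbb H^3_1,g)$ from the left transitively, effectively and by isometries, preserving also $S_\mu(t),\tilde\phi_1,\xi_1,\eta_1$, and $S_\mu(t)$ induces the trivial reductive decomposition $\mathfrak h=\{0\}$, $\mathfrak m=\mathfrak{su}(1,1)$. Here "$\mathfrak g=\mathfrak h\oplus\mathfrak m$ is the reductive decomposition induced by $S$" means the following. The subspace $\mathfrak h$ is the Lie algebra of the isotropy group $H$ of $o$, and $\mathfrak m$ is an $\mathrm{Ad}(H)$-invariant complement. Let $X^*$ be the vector field generated by $s\mapsto\exp(sX)$; the map $X\mapsto X^*|_o$ is an isomorphism $\mathfrak m\to T_o\mathbb H^3_1$. One has $\widetilde\nabla_{X^*}Y^*|_o=-([X,Y]_{\mathfrak m})^*|_o$ for $X,Y\in\mathfrak m$. Finally, identifying $\mathfrak m$ with $T_o\mathbb H^3_1$ in this way, and $\mathfrak h$ (through a suitable linear isomorphism) with the Lie algebra of endomorphisms of $T_o\mathbb H^3_1$ generated by all $\widetilde R(X,Y)$, the bracket of $\mathfrak g$ is $[U,V]=UV-VU$, $[U,X]=U(X)$, $[X,Y]=S_XY-S_YX-\widetilde R(X,Y)$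 for $U,V\in\mathfrak h$, $X,Y\in\mathfrak m$. -/

import Mathlib

open scoped ContDiff ComplexConjugate

noncomputable section

attribute [local instance 100] LieRing.ofAssociativeRing

namespace AdS3

/-! ### The hypersurface `|z¹|² - |z²|² = 1` and its differential calculus -/

/-- The ambient real vector space `ℝ^{2,2} = ℂ²`. -/
abbrev Amb : Type := ℂ × ℂ

/-- The bilinear form `Re(z̄¹ w¹) - Re(z̄² w²)` on `ℂ²`. -/
def bil (z w : Amb) : ℝ :=
  z.1.re * w.1.re + z.1.im * w.1.im - (z.2.re * w.2.re + z.2.im * w.2.im)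

/-- The quadratic form `|z¹|² - |z²|²`. -/
def quad (z : Amb) : ℝ := Complex.normSq z.1 - Complex.normSq z.2

/-- Anti-de Sitter space `H³₁` as a hypersurface in `ℂ²`. -/
def H31Set : Set Amb := {z | quad z = 1}

abbrev H31 : Type := H31Set

/-- The open cone on which `retr` is a smooth retraction onto `H31`. -/
def cone : Set Amb := {z | 0 < quad z}

lemma bil_self (z : Amb) : bil z z = quad z := by
  simp [bil, quad, Complex.normSq_apply]

lemma bil_comm (z w : Amb) : bil z w = bil w z := by
  simp only [bil]; ring

lemma quad_smul (c : ℝ) (z : Amb) : quad (c • z) = c ^ 2 * quad z := by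
  simp [quad, Complex.normSq_apply]; ring

/-- The base point `o = (1, 0)`. -/
def o : H31 := ⟨((1 : ℂ), (0 : ℂ)), by simp [H31Set, quad]⟩

open Classical in
/-- The radial retraction `z ↦ z / √(|z¹|² - |z²|²)` of `cone` onto `H31`
(with the value `o` outside `cone`). -/
def retr (z : Amb) : H31 :=
  if h : 0 < quad z then
    ⟨(Real.sqrt (quad z))⁻¹ • z, by
      simp only [H31Set, Set.mem_ofPred_eq, quad_smul, inv_pow, Real.sq_sqrt h.le]
      exact inv_mul_cancel₀ h.ne'⟩
  else o

lemma coe_mem_cone (p : H31) : (p : Amb) ∈ cone := by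
  have : quad (p : Amb) = 1 := p.2
  simp [cone, this]

lemma retr_coe (p : H31) : retr (p : Amb) = p := by
  have h : quad (p : Amb) = 1 := p.2
  apply Subtype.ext
  simp [retr, h]

/-- Smoothness of a map on the embedded submanifold `H31`: its extension along the smooth
retraction `retr` is smooth on the open set `cone`. -/
def IsSmooth {F : Type*} [NormedAddCommGroup F] [NormedSpace ℝ F] (f : H31 → F) : Prop :=
  ContDiffOn ℝ ∞ (fun z : Amb => f (retr z)) cone

/-- The differential at `p` of a map on `H31` (meaningful on tangent vectors at `p`). -/
def dif {F : Type*} [NormedAddCommGroup F] [NormedSpace ℝ F] (f : H31 → F) (p : H31) :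
    Amb →L[ℝ] F :=
  fderiv ℝ (fun z : Amb => f (retr z)) (p : Amb)

lemma contDiff_quad : ContDiff ℝ ∞ quad := by
  have h : quad = fun z : Amb => ((Complex.reCLM z.1) ^ 2 + (Complex.imCLM z.1) ^ 2) -
      ((Complex.reCLM z.2) ^ 2 + (Complex.imCLM z.2) ^ 2) := by
    funext z; simp [quad, Complex.normSq_apply]; ring
  rw [h]; fun_prop

lemma isOpen_cone : IsOpen cone :=
  isOpen_lt continuous_const contDiff_quad.continuous

lemma coe_retr {z : Amb} (h : z ∈ cone) : (retr z : Amb) = (Real.sqrt (quad z))⁻¹ • z := by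
  have h' : 0 < quad z := h
  simp [retr, h']

lemma isSmooth_coe : IsSmooth (fun p : H31 => (p : Amb)) := by
  have : ContDiffOn ℝ ∞ (fun z : Amb => (Real.sqrt (quad z))⁻¹ • z) cone := by
    have hq : ContDiffOn ℝ ∞ (fun z : Amb => Real.sqrt (quad z)) cone :=
      contDiff_quad.contDiffOn.sqrt (fun z hz => (show 0 < quad z from hz).ne')
    exact (hq.inv (fun z hz => (Real.sqrt_pos.mpr hz).ne')).smul contDiffOn_id
  exact this.congr (fun z hz => coe_retr hz)

section
variable {F F' F'' : Type*} [NormedAddCommGroup F] [NormedSpace ℝ F]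
  [NormedAddCommGroup F'] [NormedSpace ℝ F'] [NormedAddCommGroup F''] [NormedSpace ℝ F'']

lemma IsSmooth.comp {f : H31 → F} (hf : IsSmooth f) {L : F → F'} (hL : ContDiff ℝ ∞ L) :
    IsSmooth (fun p => L (f p)) :=
  hL.comp_contDiffOn hf

lemma IsSmooth.prodMk {f : H31 → F} {f' : H31 → F'} (hf : IsSmooth f) (hf' : IsSmooth f') :
    IsSmooth (fun p => (f p, f' p)) :=
  ContDiffOn.prodMk hf hf'

lemma IsSmooth.dif_apply {f : H31 → F} (hf : IsSmooth f) {X : H31 → Amb} (hX : IsSmooth X) :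
    IsSmooth (fun p => dif f p (X p)) := by
  have h1 : ContDiffOn ℝ ∞ (fderiv ℝ (fun z : Amb => f (retr z))) cone :=
    hf.fderiv_of_isOpen isOpen_cone (by simp)
  have h2 := h1.comp isSmooth_coe (fun z _ => coe_mem_cone (retr z))
  exact h2.clm_apply hX

lemma IsSmooth.differentiableAt {f : H31 → F} (hf : IsSmooth f) (p : H31) :
    DifferentiableAt ℝ (fun z : Amb => f (retr z)) (p : Amb) :=
  (hf.contDiffAt (isOpen_cone.mem_nhds (coe_mem_cone p))).differentiableAt (by simp)

end

/-- The tangent space of `H31` at `p`: the kernel of the differential of `quad`. -/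
def tangent (p : H31) : Submodule ℝ Amb where
  carrier := {v | bil p v = 0}
  add_mem' {a b} ha hb := by
    simp only [Set.mem_ofPred_eq, bil, Prod.fst_add, Prod.snd_add, Complex.add_re,
      Complex.add_im] at *
    linear_combination ha + hb
  zero_mem' := by simp [bil]
  smul_mem' c a ha := by
    simp only [Set.mem_ofPred_eq, bil, Prod.smul_fst, Prod.smul_snd, Complex.real_smul,
      Complex.re_ofReal_mul, Complex.im_ofReal_mul] at *
    linear_combination c * ha

lemma mem_tangent {p : H31} {v : Amb} : v ∈ tangent p ↔ bil p v = 0 := Iff.rfl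

/-- The algebra `C^∞(H31)`, as a subalgebra of all functions. -/
def smoothSubalgebra : Subalgebra ℝ (H31 → ℝ) where
  carrier := {f | IsSmooth f}
  mul_mem' ha hb := ContDiffOn.mul ha hb
  add_mem' ha hb := ContDiffOn.add ha hb
  algebraMap_mem' _ := contDiffOn_const

/-- The algebra `C^∞(H31)`. -/
def SmoothFun : Type := smoothSubalgebra

instance : CommRing SmoothFun := inferInstanceAs (CommRing smoothSubalgebra)
instance : Algebra ℝ SmoothFun := inferInstanceAs (Algebra ℝ smoothSubalgebra)
instance : CoeFun SmoothFun (fun _ => H31 → ℝ) := ⟨fun f => f.1⟩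

lemma SmoothFun.smooth (f : SmoothFun) : IsSmooth f := f.2

@[ext] lemma SmoothFun.ext {f g : SmoothFun} (h : ∀ p, f p = g p) : f = g :=
  Subtype.ext (funext h)

@[simp] lemma SmoothFun.mk_apply (f : H31 → ℝ) (hf : IsSmooth f) (p : H31) :
    (show SmoothFun from ⟨f, hf⟩) p = f p := rfl
@[simp] lemma SmoothFun.add_apply (f g : SmoothFun) (p : H31) : (f + g) p = f p + g p := rfl
@[simp] lemma SmoothFun.sub_apply (f g : SmoothFun) (p : H31) : (f - g) p = f p - g p := rfl
@[simp] lemma SmoothFun.neg_apply (f : SmoothFun) (p : H31) : (-f) p = -f p := rfl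
@[simp] lemma SmoothFun.mul_apply (f g : SmoothFun) (p : H31) : (f * g) p = f p * g p := rfl
@[simp] lemma SmoothFun.zero_apply (p : H31) : (0 : SmoothFun) p = 0 := rfl
@[simp] lemma SmoothFun.one_apply (p : H31) : (1 : SmoothFun) p = 1 := rfl
@[simp] lemma SmoothFun.smul_apply (c : ℝ) (f : SmoothFun) (p : H31) : (c • f) p = c * f p := rfl
@[simp] lemma SmoothFun.algebraMap_apply (c : ℝ) (p : H31) :
    (algebraMap ℝ SmoothFun c) p = c := rfl

/-- The real vector space of smooth tangent vector fields, as a subspace of all maps to `ℂ²`. -/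
def vfieldSubmodule : Submodule ℝ (H31 → Amb) where
  carrier := {X | (∀ p, X p ∈ tangent p) ∧ IsSmooth X}
  add_mem' ha hb := ⟨fun p => (tangent p).add_mem (ha.1 p) (hb.1 p), ContDiffOn.add ha.2 hb.2⟩
  zero_mem' := ⟨fun p => (tangent p).zero_mem, contDiffOn_const⟩
  smul_mem' _ _ ha :=
    ⟨fun p => (tangent p).smul_mem _ (ha.1 p), ContDiffOn.smul contDiffOn_const ha.2⟩

/-- Smooth tangent vector fields on `H31`. -/
def VField : Type := vfieldSubmodule

instance : AddCommGroup VField := inferInstanceAs (AddCommGroup vfieldSubmodule)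
instance : Module ℝ VField := inferInstanceAs (Module ℝ vfieldSubmodule)
instance : CoeFun VField (fun _ => H31 → Amb) := ⟨fun X => X.1⟩

lemma VField.mem (X : VField) (p : H31) : X p ∈ tangent p := X.2.1 p
lemma VField.smooth (X : VField) : IsSmooth X := X.2.2

@[ext] lemma VField.ext {X Y : VField} (h : ∀ p, X p = Y p) : X = Y := Subtype.ext (funext h)

instance : SMul SmoothFun VField :=
  ⟨fun f X => ⟨fun p => f p • X p, fun p => (tangent p).smul_mem _ (X.mem p),
    ContDiffOn.smul f.smooth X.smooth⟩⟩

@[simp] lemma VField.add_apply (X Y : VField) (p : H31) : (X + Y) p = X p + Y p := rfl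
@[simp] lemma VField.sub_apply (X Y : VField) (p : H31) : (X - Y) p = X p - Y p := rfl
@[simp] lemma VField.neg_apply (X : VField) (p : H31) : (-X) p = -X p := rfl
@[simp] lemma VField.zero_apply (p : H31) : (0 : VField) p = 0 := rfl
@[simp] lemma VField.smul_apply (c : ℝ) (X : VField) (p : H31) : (c • X) p = c • X p := rfl
@[simp] lemma VField.fsmul_apply (f : SmoothFun) (X : VField) (p : H31) :
    (f • X) p = f p • X p := rfl

instance : Module SmoothFun VField where
  one_smul X := by ext1 p; simp
  mul_smul f g X := by ext1 p; simp [mul_smul]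
  smul_zero f := by ext1 p; simp
  smul_add f X Y := by ext1 p; simp
  add_smul f g X := by ext1 p; simp [add_smul]
  zero_smul X := by ext1 p; simp

instance : IsScalarTower ℝ SmoothFun VField := ⟨fun c f X => by ext1 p; simp [mul_smul]⟩
instance : SMulCommClass ℝ SmoothFun VField := ⟨fun c f X => by ext1 p; simp [smul_comm c]⟩
instance : SMulCommClass SmoothFun ℝ VField := SMulCommClass.symm _ _ _

/-- The value of a vector field at a point, as a tangent vector. -/
def VField.at (X : VField) (p : H31) : tangent p := ⟨X p, X.mem p⟩

/-- The derivative `X(f)`. -/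
def dirDeriv (X : VField) (f : SmoothFun) : SmoothFun :=
  ⟨fun p => dif f p (X p), IsSmooth.dif_apply f.smooth X.smooth⟩

lemma hasFDerivAt_bil (f g : Amb → Amb) (x : Amb) (f' g' : Amb →L[ℝ] Amb)
    (hf : HasFDerivAt f f' x) (hg : HasFDerivAt g g' x) (v : Amb) :
    fderiv ℝ (fun z => bil (f z) (g z)) x v = bil (f' v) (g x) + bil (f x) (g' v) := by
  have re1 (u : Amb → Amb) (u' : Amb →L[ℝ] Amb) (hu : HasFDerivAt u u' x) :=
    Complex.reCLM.hasFDerivAt.comp x (HasFDerivAt.fst hu)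
  have im1 (u : Amb → Amb) (u' : Amb →L[ℝ] Amb) (hu : HasFDerivAt u u' x) :=
    Complex.imCLM.hasFDerivAt.comp x (HasFDerivAt.fst hu)
  have re2 (u : Amb → Amb) (u' : Amb →L[ℝ] Amb) (hu : HasFDerivAt u u' x) :=
    Complex.reCLM.hasFDerivAt.comp x (HasFDerivAt.snd hu)
  have im2 (u : Amb → Amb) (u' : Amb →L[ℝ] Amb) (hu : HasFDerivAt u u' x) :=
    Complex.imCLM.hasFDerivAt.comp x (HasFDerivAt.snd hu)
  have h := (((re1 f f' hf).mul (re1 g g' hg)).add ((im1 f f' hf).mul (im1 g g' hg))).sub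
    (((re2 f f' hf).mul (re2 g g' hg)).add ((im2 f f' hf).mul (im2 g g' hg)))
  have h' := h.fderiv
  have e : (fun z => bil (f z) (g z)) = (((⇑Complex.reCLM ∘ fun z => (f z).1) *
      (⇑Complex.reCLM ∘ fun z => (g z).1) + (⇑Complex.imCLM ∘ fun z => (f z).1) *
      (⇑Complex.imCLM ∘ fun z => (g z).1)) - ((⇑Complex.reCLM ∘ fun z => (f z).2) *
      (⇑Complex.reCLM ∘ fun z => (g z).2) + (⇑Complex.imCLM ∘ fun z => (f z).2) *
      (⇑Complex.imCLM ∘ fun z => (g z).2))) := by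
    funext z; simp [bil]
  rw [e, h']
  simp [bil]
  ring

lemma dif_coe (p : H31) (v : Amb) (hv : v ∈ tangent p) :
    dif (fun q : H31 => (q : Amb)) p v = v := by
  have hp : quad (p : Amb) = 1 := p.2
  have hq : HasFDerivAt quad (fderiv ℝ quad p) (p : Amb) :=
    (contDiff_quad.differentiable (by simp) _).hasFDerivAt
  have hqv : fderiv ℝ quad p v = 0 := by
    have := hasFDerivAt_bil id id (p : Amb) _ _ (hasFDerivAt_id _) (hasFDerivAt_id _) v
    have e : (fun z : Amb => bil (id z) (id z)) = quad := by funext z; exact bil_self z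
    rw [e] at this
    rw [this]
    have h0 : bil p v = 0 := hv
    simp [bil_comm v, h0]
  have h1 := (hasDerivAt_inv (x := Real.sqrt (quad p)) (by rw [hp]; simp)).comp_hasFDerivAt
    (p : Amb) (hq.sqrt (by rw [hp]; norm_num))
  have h2 := h1.smul (hasFDerivAt_id (𝕜 := ℝ) (p : Amb))
  have ev : (fun z : Amb => (retr z : Amb)) =ᶠ[nhds (p : Amb)]
      (fun z => (Real.sqrt (quad z))⁻¹ • z) :=
    Filter.eventually_of_mem (isOpen_cone.mem_nhds (coe_mem_cone p)) (fun z hz => coe_retr hz)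
  have h3 := (h2.congr_of_eventuallyEq ev).fderiv
  simp only [dif]
  rw [h3]
  simp [hp, hqv]

lemma bil_dif (X Y : VField) (p : H31) :
    bil (X p) (Y p) + bil p (dif Y p (X p)) = 0 := by
  have h := hasFDerivAt_bil (fun z => (retr z : Amb)) (fun z => Y (retr z)) (p : Amb) _ _
    (isSmooth_coe.differentiableAt p).hasFDerivAt
    (Y.smooth.differentiableAt p).hasFDerivAt (X p)
  have e : (fun z : Amb => bil (retr z : Amb) (Y (retr z))) = fun _ => (0 : ℝ) := by
    funext z; exact Y.mem (retr z)
  rw [e] at h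
  have h1 := dif_coe p (X p) (X.mem p)
  simp only [dif] at h1
  simp only [retr_coe] at h
  rw [h1] at h
  simp only [dif]
  rw [← h]; simp

/-- The Lie bracket `[X, Y] = D_X Y - D_Y X` of vector fields on `H31`. -/
def bracket (X Y : VField) : VField :=
  ⟨fun p => dif Y p (X p) - dif X p (Y p), fun p => by
      have h1 := bil_dif X Y p
      have h2 := bil_dif Y X p
      rw [bil_comm] at h1
      rw [mem_tangent]
      have : bil p (dif Y p (X p) - dif X p (Y p)) =
          bil p (dif Y p (X p)) - bil p (dif X p (Y p)) := by
        simp [bil]; ring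
      rw [this]; linarith,
    ContDiffOn.sub (IsSmooth.dif_apply Y.smooth X.smooth) (IsSmooth.dif_apply X.smooth Y.smooth)⟩

/-! ### Tensor fields, connections, curvature -/

/-- One-forms. -/
abbrev Form1 : Type := VField →ₗ[SmoothFun] SmoothFun
/-- Tensor fields of type `(0,2)`. -/
abbrev Tensor02 : Type := VField →ₗ[SmoothFun] VField →ₗ[SmoothFun] SmoothFun
/-- Tensor fields of type `(0,3)`. -/
abbrev Tensor03 : Type :=
  VField →ₗ[SmoothFun] VField →ₗ[SmoothFun] VField →ₗ[SmoothFun] SmoothFun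
/-- Tensor fields of type `(1,1)`. -/
abbrev Tensor11 : Type := VField →ₗ[SmoothFun] VField
/-- Tensor fields of type `(1,2)`, `S X Y = S_X Y`. -/
abbrev Tensor12 : Type := VField →ₗ[SmoothFun] VField →ₗ[SmoothFun] VField

/-- `(α ⊗ T)(X, …) = α(X) T(…)`; also `α ⊗ Z` for a vector field `Z`. -/
def tens {M : Type*} [AddCommMonoid M] [Module SmoothFun M] (α : Form1) (T : M) :
    VField →ₗ[SmoothFun] M :=
  α.smulRight T

/-- `α ∧ β = α ⊗ β - β ⊗ α`. -/
def wedge (α β : Form1) : Tensor02 := tens α β - tens β α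

/-- A Lorentzian metric: symmetric, and with an orthonormal basis of signature `(-,+,+)` in
every tangent space (which is three-dimensional). -/
structure IsLorentzian (g : Tensor02) : Prop where
  symm : ∀ X Y, g X Y = g Y X
  signature : ∀ p : H31, ∃ e : Fin 3 → VField, ∀ i j,
    g (e i) (e j) p = if i = j then (if i = 0 then -1 else 1) else 0

/-- Affine connections on the tangent bundle of `H31`. -/
@[ext] structure AffineConnection where
  nab : VField →ₗ[SmoothFun] VField →ₗ[ℝ] VField
  leibniz : ∀ (X : VField) (f : SmoothFun) (Y : VField),
    nab X (f • Y) = dirDeriv X f • Y + f • nab X Y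

/-- The connection `∇ - S`. -/
def AffineConnection.subTensor (D : AffineConnection) (S : Tensor12) : AffineConnection where
  nab :=
    { toFun := fun X => D.nab X - (S X).restrictScalars ℝ
      map_add' := fun X Y => by ext1 Z; simp; abel
      map_smul' := fun f X => by ext1 Z; simp [smul_sub] }
  leibniz X f Y := by simp [D.leibniz, smul_sub]; abel

/-- Torsion-free and metric: the Levi-Civita connection of `g`. -/
structure IsLeviCivita (g : Tensor02) (D : AffineConnection) : Prop where
  torsionFree : ∀ X Y, D.nab X Y - D.nab Y X = bracket X Y
  metric : ∀ X Y Z, dirDeriv X (g Y Z) = g (D.nab X Y) Z + g Y (D.nab X Z)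

/-- `R(X,Y)Z = ∇_X ∇_Y Z - ∇_Y ∇_X Z - ∇_{[X,Y]} Z`. -/
def curv (D : AffineConnection) (X Y Z : VField) : VField :=
  D.nab X (D.nab Y Z) - D.nab Y (D.nab X Z) - D.nab (bracket X Y) Z

/-- `S` (of type `(0,3)`) and `T` (of type `(1,2)`) correspond to each other by
`S(X,Y,Z) = g(T_X Y, Z)`. -/
def IsAssociated (g : Tensor02) (S : Tensor03) (T : Tensor12) : Prop :=
  ∀ X Y Z, S X Y Z = g (T X Y) Z

/-- `D g = 0`. -/
def ParallelMetric (D : AffineConnection) (g : Tensor02) : Prop :=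
  ∀ X Y Z, dirDeriv X (g Y Z) - g (D.nab X Y) Z - g Y (D.nab X Z) = 0

/-- `D R = 0`, where `R` is the curvature tensor field of `D₀`. -/
def ParallelCurvature (D D₀ : AffineConnection) : Prop :=
  ∀ X Y Z W, D.nab X (curv D₀ Y Z W) - curv D₀ (D.nab X Y) Z W - curv D₀ Y (D.nab X Z) W
    - curv D₀ Y Z (D.nab X W) = 0

/-- `D T = 0` for a `(1,2)`-tensor field. -/
def Parallel12 (D : AffineConnection) (T : Tensor12) : Prop :=
  ∀ X Y Z, D.nab X (T Y Z) - T (D.nab X Y) Z - T Y (D.nab X Z) = 0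

/-- `(D_X φ) Y`. -/
def covDeriv11 (D : AffineConnection) (φ : Tensor11) (X Y : VField) : VField :=
  D.nab X (φ Y) - φ (D.nab X Y)

/-- `(D_X η) Y`. -/
def covDeriv1 (D : AffineConnection) (η : Form1) (X Y : VField) : SmoothFun :=
  dirDeriv X (η Y) - η (D.nab X Y)

/-- Homogeneous pseudo-Riemannian structure `S` on `(H31, g)`; `D` is the Levi-Civita
connection of `g`. -/
structure IsHomogeneousStructure (g : Tensor02) (D : AffineConnection) (S : Tensor12) : Prop where
  metric : ParallelMetric (D.subTensor S) g
  curvature : ParallelCurvature (D.subTensor S) D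
  tensor : Parallel12 (D.subTensor S) S

/-- Almost paracontact metric structure. -/
structure IsAlmostParacontactMetric (g : Tensor02) (φ : Tensor11) (ξ : VField) (η : Form1) :
    Prop where
  sq : ∀ X, φ (φ X) = X - η X • ξ
  reeb : η ξ = 1
  compatible : ∀ X Y, g (φ X) (φ Y) = -g X Y + η X * η Y

/-- `β`-paraSasakian structure; `D` is the Levi-Civita connection of `g`. -/
structure IsParaSasakian (g : Tensor02) (D : AffineConnection) (φ : Tensor11) (ξ : VField)
    (η : Form1) (β : SmoothFun) : Prop extends IsAlmostParacontactMetric g φ ξ η where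
  cov : ∀ X Y, covDeriv11 D φ X Y = β • (g X Y • ξ - η Y • X)

/-- Homogeneous almost paracontact metric structure `(S, φ, ξ, η)` on `(H31, g)`; `D` is the
Levi-Civita connection of `g`. -/
structure IsHomogeneousAlmostParacontactMetric (g : Tensor02) (D : AffineConnection)
    (S : Tensor12) (φ : Tensor11) (ξ : VField) (η : Form1) : Prop
    extends IsHomogeneousStructure g D S, IsAlmostParacontactMetric g φ ξ η where
  parallel_phi : ∀ X Y, covDeriv11 (D.subTensor S) φ X Y = 0
  parallel_xi : ∀ X, (D.subTensor S).nab X ξ = 0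
  parallel_eta : ∀ X Y, covDeriv1 (D.subTensor S) η X Y = 0

/-! ### The left-invariant frame and the metrics of Kaluza-Klein type -/

lemma isSmooth_linear (L : Amb →ₗ[ℝ] Amb) : IsSmooth (fun p : H31 => L p) :=
  isSmooth_coe.comp (L := L) (LinearMap.toContinuousLinearMap L).contDiff

/-- The matrices `X₀, X₁, X₂` of `su(1,1)`. -/
def pauli : Fin 3 → Matrix (Fin 2) (Fin 2) ℂ :=
  ![!![Complex.I, 0; 0, -Complex.I], !![0, 1; 1, 0], !![0, Complex.I; -Complex.I, 0]]

/-- The linear map `z ↦ (z¹, z²) · X_α` of `ℂ²`: right multiplication by `X_α` in the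
identification of `z` with the matrix with first row `z`. -/
def rightMul (α : Fin 3) : Amb →ₗ[ℝ] Amb where
  toFun z := (z.1 * pauli α 0 0 + z.2 * pauli α 1 0, z.1 * pauli α 0 1 + z.2 * pauli α 1 1)
  map_add' z w := by ext1 <;> simp <;> ring
  map_smul' c z := by ext1 <;> simp <;> ring

/-- The left-invariant vector fields `X₀, X₁, X₂` on `H31`. -/
def frame (α : Fin 3) : VField :=
  ⟨fun p => rightMul α p, fun p => by
      rw [mem_tangent]
      fin_cases α <;> simp [rightMul, pauli, bil] <;> ring,
    isSmooth_linear (rightMul α)⟩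

/-- The coefficients of `v ∈ T_z H31` in the frame `X₀, X₁, X₂`. -/
def coeff (z v : Amb) : Fin 3 → ℝ :=
  ![(conj z.1 * v.1 - z.2 * conj v.2).im, (conj z.1 * v.2 - z.2 * conj v.1).re,
    (conj z.1 * v.2 - z.2 * conj v.1).im]

lemma isSmooth_coeff (X : VField) (α : Fin 3) : IsSmooth (fun p : H31 => coeff p (X p) α) := by
  have h : ContDiff ℝ ∞ (fun w : Amb × Amb => coeff w.1 w.2 α) := by
    fin_cases α
    · change ContDiff ℝ ∞ (fun w : Amb × Amb => Complex.imCLM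
        (Complex.conjCLE w.1.1 * w.2.1 - w.1.2 * Complex.conjCLE w.2.2))
      fun_prop
    · change ContDiff ℝ ∞ (fun w : Amb × Amb => Complex.reCLM
        (Complex.conjCLE w.1.1 * w.2.2 - w.1.2 * Complex.conjCLE w.2.1))
      fun_prop
    · change ContDiff ℝ ∞ (fun w : Amb × Amb => Complex.imCLM
        (Complex.conjCLE w.1.1 * w.2.2 - w.1.2 * Complex.conjCLE w.2.1))
      fun_prop
  exact (isSmooth_coe.prodMk X.smooth).comp h

/-- The coefficient of `X` along `X_α`, as a smooth function. -/
def coeffFun (X : VField) (α : Fin 3) : SmoothFun :=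
  ⟨fun p => coeff p (X p) α, isSmooth_coeff X α⟩

@[simp] lemma coeffFun_apply (X : VField) (α : Fin 3) (p : H31) :
    coeffFun X α p = coeff p (X p) α := rfl

@[simp] lemma frame_apply (α : Fin 3) (p : H31) : frame α p = rightMul α p := rfl

/-- The left-invariant vector fields form a basis of the module of vector fields. -/
def frameBasis : Module.Basis (Fin 3) SmoothFun VField :=
  Module.Basis.ofEquivFun
    { toFun := coeffFun
      map_add' := fun X Y => by
        funext α; ext1 p
        fin_cases α <;> simp [coeff] <;> ring
      map_smul' := fun f X => by
        funext α; ext1 p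
        fin_cases α <;> simp [coeff] <;> ring
      invFun := fun f => ∑ α, f α • frame α
      left_inv := fun X => by
        ext1 p
        have hp : quad (p : Amb) = 1 := p.2
        have hX : bil p (X p) = 0 := X.mem p
        simp only [quad, bil, Complex.normSq_apply] at hp hX
        ext1 <;> apply Complex.ext <;>
          simp [Fin.sum_univ_three, coeff, rightMul, pauli]
        · linear_combination (X p).1.re * hp - (p : Amb).1.re * hX
        · linear_combination (X p).1.im * hp - (p : Amb).1.im * hX
        · linear_combination (X p).2.re * hp - (p : Amb).2.re * hX
        · linear_combination (X p).2.im * hp - (p : Amb).2.im * hX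
      right_inv := fun f => by
        funext α; ext1 p
        have hp : quad (p : Amb) = 1 := p.2
        simp only [quad, Complex.normSq_apply] at hp
        fin_cases α <;> simp [Fin.sum_univ_three, coeff, rightMul, pauli]
        · linear_combination f 0 p * hp
        · linear_combination f 1 p * hp
        · linear_combination f 2 p * hp }

/-- The dual frame `θ⁰, θ¹, θ²`. -/
def coframe (α : Fin 3) : Form1 := frameBasis.coord α

/-- The metric `g_{λμν} = λ θ⁰⊗θ⁰ + μ θ¹⊗θ¹ + ν θ²⊗θ²`. -/
def kkMetric (lam mu nu : ℝ) : Tensor02 :=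
  lam • tens (coframe 0) (coframe 0) + mu • tens (coframe 1) (coframe 1) +
    nu • tens (coframe 2) (coframe 2)

/-- `S_μ(t) = μ θ²⊗(θ⁰∧θ¹) + μ θ⁰⊗(θ¹∧θ²) + t θ¹⊗(θ²∧θ⁰)`. -/
def Smu (mu t : ℝ) : Tensor03 :=
  mu • tens (coframe 2) (wedge (coframe 0) (coframe 1)) +
    mu • tens (coframe 0) (wedge (coframe 1) (coframe 2)) +
    t • tens (coframe 1) (wedge (coframe 2) (coframe 0))

/-- The lengths `√|λ|, √μ, √ν` of the frame vectors. -/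
def frameLength (lam mu nu : ℝ) : Fin 3 → ℝ := ![Real.sqrt |lam|, Real.sqrt mu, Real.sqrt nu]

/-- The orthonormal frame `X₀/√|λ|, X₁/√μ, X₂/√ν`. -/
def unitFrame (lam mu nu : ℝ) (α : Fin 3) : VField := (frameLength lam mu nu α)⁻¹ • frame α

/-- The dual of the orthonormal frame. -/
def unitCoframe (lam mu nu : ℝ) (α : Fin 3) : Form1 := frameLength lam mu nu α • coframe α

/-- `φ̃₁ = -X̄₂ ⊗ θ̄⁰ - X̄₀ ⊗ θ̄²`. -/
def phi1 (lam mu nu : ℝ) : Tensor11 :=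
  -tens (unitCoframe lam mu nu 0) (unitFrame lam mu nu 2) -
    tens (unitCoframe lam mu nu 2) (unitFrame lam mu nu 0)

/-- `ξ₁ = X̄₁`. -/
def xi1 (lam mu nu : ℝ) : VField := unitFrame lam mu nu 1

/-- `η₁ = θ̄¹`. -/
def eta1 (lam mu nu : ℝ) : Form1 := unitCoframe lam mu nu 1

/-! ### The groups `SU(1,1)` and `SU(1,1) × ℝ` and their actions -/

open Matrix

/-- `diag(1, -1)`. -/
def J : Matrix (Fin 2) (Fin 2) ℂ := !![1, 0; 0, -1]

lemma J_mul_J : J * J = 1 := by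
  ext i j; fin_cases i <;> fin_cases j <;> simp [J, Matrix.mul_apply, Fin.sum_univ_two]

/-- `SU(1,1)`: the complex `2 × 2` matrices `A` with `det A = 1` and `A^* J A = J`. -/
def SU11Subgroup : Subgroup (Matrix.SpecialLinearGroup (Fin 2) ℂ) where
  carrier := {A | (A : Matrix (Fin 2) (Fin 2) ℂ)ᴴ * J * A = J}
  mul_mem' {A B} hA hB := by
    simp only [Set.mem_ofPred_eq, Matrix.SpecialLinearGroup.coe_mul,
      Matrix.conjTranspose_mul] at *
    calc _ = (B : Matrix (Fin 2) (Fin 2) ℂ)ᴴ * ((A : Matrix (Fin 2) (Fin 2) ℂ)ᴴ * J * A) * B := by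
          simp only [Matrix.mul_assoc]
      _ = J := by rw [hA, hB]
  one_mem' := by simp
  inv_mem' {A} hA := by
    simp only [Set.mem_ofPred_eq] at *
    have h1 : (A : Matrix (Fin 2) (Fin 2) ℂ) * ((A⁻¹ : Matrix.SpecialLinearGroup (Fin 2) ℂ) :
        Matrix (Fin 2) (Fin 2) ℂ) = 1 := by
      rw [← Matrix.SpecialLinearGroup.coe_mul, mul_inv_cancel, Matrix.SpecialLinearGroup.coe_one]
    have h2 := congrArg Matrix.conjTranspose h1
    rw [Matrix.conjTranspose_mul, Matrix.conjTranspose_one] at h2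
    generalize ((A⁻¹ : Matrix.SpecialLinearGroup (Fin 2) ℂ) : Matrix (Fin 2) (Fin 2) ℂ) = B at *
    calc Bᴴ * J * B = Bᴴ * ((A : Matrix (Fin 2) (Fin 2) ℂ)ᴴ * J * A) * B := by rw [hA]
      _ = (Bᴴ * (A : Matrix (Fin 2) (Fin 2) ℂ)ᴴ) * J * (A * B) := by simp only [Matrix.mul_assoc]
      _ = J := by rw [h1, h2]; simp

/-- The group `SU(1,1)`. -/
def SU11 : Type := SU11Subgroup

instance : Group SU11 := inferInstanceAs (Group SU11Subgroup)

/-- The matrix of an element of `SU(1,1)`. -/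
def SU11.mat (A : SU11) : Matrix (Fin 2) (Fin 2) ℂ := (A.1 : Matrix (Fin 2) (Fin 2) ℂ)

lemma SU11.mat_mul (A B : SU11) : (A * B).mat = A.mat * B.mat := rfl

@[simp] lemma SU11.mat_one : (1 : SU11).mat = 1 := rfl

@[ext] lemma SU11.ext {A B : SU11} (h : A.mat = B.mat) : A = B := Subtype.ext (Subtype.ext h)

lemma SU11.det_mat (A : SU11) : A.mat.det = 1 := A.1.2

lemma SU11.mat_mem (A : SU11) : A.matᴴ * J * A.mat = J := A.2

/-- A matrix with determinant `1` and `A^* J A = J` as an element of `SU(1,1)`. -/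
def SU11.mk (A : Matrix (Fin 2) (Fin 2) ℂ) (h : A.det = 1) (h' : Aᴴ * J * A = J) : SU11 :=
  ⟨⟨A, h⟩, h'⟩

@[simp] lemma SU11.mat_mk (A : Matrix (Fin 2) (Fin 2) ℂ) (h : A.det = 1) (h' : Aᴴ * J * A = J) :
    (SU11.mk A h h').mat = A := rfl

lemma SU11.entries (A : SU11) :
    A.mat 1 0 = conj (A.mat 0 1) ∧ A.mat 1 1 = conj (A.mat 0 0) := by
  have hd := A.det_mat
  have h := A.mat_mem
  rw [Matrix.det_fin_two] at hd
  have h00 := congrFun (congrFun h 0) 0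
  have h01 := congrFun (congrFun h 0) 1
  have h11 := congrFun (congrFun h 1) 1
  have h10 := congrFun (congrFun h 1) 0
  simp [J, Matrix.mul_apply, Fin.sum_univ_two] at h00 h01 h11 h10
  constructor
  · linear_combination (conj (A.mat 0 1)) * hd - A.mat 1 1 * h10 + A.mat 1 0 * h11
  · linear_combination (conj (A.mat 0 0)) * hd - A.mat 1 1 * h00 + A.mat 1 0 * h01

/-- The identification of `(z¹, z²) ∈ H31` with the matrix `(z¹, z²; z̄², z̄¹) ∈ SU(1,1)`. -/
def toSU : H31 ≃ SU11 where
  toFun z := SU11.mk !![(z : Amb).1, (z : Amb).2; conj (z : Amb).2, conj (z : Amb).1]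
    (by
      have hz : quad (z : Amb) = 1 := z.2
      simp only [quad] at hz
      rw [Matrix.det_fin_two_of, Complex.mul_conj, Complex.mul_conj, ← Complex.ofReal_sub, hz,
        Complex.ofReal_one])
    (by
      have hz : quad (z : Amb) = 1 := z.2
      simp only [quad] at hz
      have hz' : (z : Amb).1 * conj (z : Amb).1 - (z : Amb).2 * conj (z : Amb).2 = 1 := by
        rw [Complex.mul_conj, Complex.mul_conj, ← Complex.ofReal_sub, hz, Complex.ofReal_one]
      ext i j
      fin_cases i <;> fin_cases j <;> simp [J, Matrix.mul_apply, Fin.sum_univ_two]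
      · linear_combination hz'
      · ring
      · ring
      · linear_combination -hz')
  invFun A := ⟨(A.mat 0 0, A.mat 0 1), by
    have hd := A.det_mat
    rw [Matrix.det_fin_two, A.entries.1, A.entries.2, Complex.mul_conj, Complex.mul_conj,
      ← Complex.ofReal_sub] at hd
    exact_mod_cast hd⟩
  left_inv z := by ext1; simp
  right_inv A := by
    ext i j
    fin_cases i <;> fin_cases j <;> simp [A.entries.1, A.entries.2]

/-- The one-parameter subgroup `s ↦ (cosh s, -sinh s; -sinh s, cosh s)` of `SU(1,1)`. -/
def hopf (s : ℝ) : SU11 :=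
  SU11.mk !![(Real.cosh s : ℂ), -(Real.sinh s : ℂ); -(Real.sinh s : ℂ), (Real.cosh s : ℂ)]
    (by
      rw [Matrix.det_fin_two_of]
      have := Real.cosh_sq_sub_sinh_sq s
      have h : (Real.cosh s : ℂ) ^ 2 - (Real.sinh s : ℂ) ^ 2 = 1 := by exact_mod_cast this
      linear_combination h)
    (by
      have := Real.cosh_sq_sub_sinh_sq s
      have h : (Real.cosh s : ℂ) ^ 2 - (Real.sinh s : ℂ) ^ 2 = 1 := by exact_mod_cast this
      ext i j
      fin_cases i <;> fin_cases j <;>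
        simp [J, Matrix.mul_apply, Fin.sum_univ_two, -Complex.ofReal_cosh, -Complex.ofReal_sinh]
      · linear_combination h
      · ring
      · ring
      · linear_combination -h)

lemma hopf_zero : hopf 0 = 1 := by
  ext i j
  fin_cases i <;> fin_cases j <;> simp [hopf]

lemma hopf_add (s t : ℝ) : hopf (s + t) = hopf s * hopf t := by
  ext i j
  rw [SU11.mat_mul]
  fin_cases i <;> fin_cases j <;>
    simp [hopf, Matrix.mul_apply, Fin.sum_univ_two, Complex.cosh_add, Complex.sinh_add] <;> ring

/-- The left action of `SU(1,1)` on `H31 ≅ SU(1,1)`. -/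
instance : MulAction SU11 H31 where
  smul A Z := toSU.symm (A * toSU Z)
  one_smul Z := by
    change toSU.symm (1 * toSU Z) = Z
    simp
  mul_smul A B Z := by
    change toSU.symm (A * B * toSU Z) = toSU.symm (A * toSU (toSU.symm (B * toSU Z)))
    simp [mul_assoc]

/-- The group `SU(1,1) × ℝ` (the second factor written multiplicatively). -/
abbrev SU11R : Type := SU11 × Multiplicative ℝ

/-- The action `((A, s), Z) ↦ A Z (cosh s, -sinh s; -sinh s, cosh s)` of `SU(1,1) × ℝ` on
`H31 ≅ SU(1,1)`. -/
instance : MulAction SU11R H31 where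
  smul a Z := toSU.symm (a.1 * toSU Z * hopf a.2.toAdd)
  one_smul Z := by
    change toSU.symm (1 * toSU Z * hopf 0) = Z
    simp [hopf_zero]
  mul_smul a b Z := by
    change toSU.symm (a.1 * b.1 * toSU Z * hopf (a.2.toAdd + b.2.toAdd)) =
      toSU.symm (a.1 * toSU (toSU.symm (b.1 * toSU Z * hopf b.2.toAdd)) * hopf a.2.toAdd)
    rw [add_comm, hopf_add]
    simp [mul_assoc]

/-- The real Lie algebra `su(1,1)`: `X^* J + J X = 0` and `tr X = 0`. -/
def su11 : LieSubalgebra ℝ (Matrix (Fin 2) (Fin 2) ℂ) where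
  carrier := {X | Xᴴ * J + J * X = 0 ∧ X.trace = 0}
  add_mem' {X Y} hX hY := by
    refine ⟨?_, by rw [Matrix.trace_add, hX.2, hY.2, add_zero]⟩
    have : (X + Y)ᴴ * J + J * (X + Y) = (Xᴴ * J + J * X) + (Yᴴ * J + J * Y) := by
      rw [Matrix.conjTranspose_add, add_mul, mul_add]; abel
    rw [this, hX.1, hY.1, add_zero]
  zero_mem' := by simp
  smul_mem' c X hX := by
    refine ⟨?_, by rw [Matrix.trace_smul, hX.2, smul_zero]⟩
    have : (c • X)ᴴ * J + J * (c • X) = c • (Xᴴ * J + J * X) := by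
      rw [Matrix.conjTranspose_smul]; simp
    rw [this, hX.1, smul_zero]
  lie_mem' {X Y} hX hY := by
    have h1 : Xᴴ * J = -(J * X) := eq_neg_of_add_eq_zero_left hX.1
    have h2 : Yᴴ * J = -(J * Y) := eq_neg_of_add_eq_zero_left hY.1
    refine ⟨?_, by rw [Ring.lie_def, Matrix.trace_sub, Matrix.trace_mul_comm, sub_self]⟩
    rw [Ring.lie_def, Matrix.conjTranspose_sub, Matrix.conjTranspose_mul,
      Matrix.conjTranspose_mul, sub_mul, Matrix.mul_assoc, Matrix.mul_assoc, h1, h2,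
      Matrix.mul_neg, Matrix.mul_neg, ← Matrix.mul_assoc, ← Matrix.mul_assoc, h1, h2, mul_sub,
      Matrix.neg_mul, Matrix.neg_mul, Matrix.mul_assoc, Matrix.mul_assoc]
    abel

/-- The basis `X₀, X₁, X₂` of `su(1,1)`. -/
def B (α : Fin 3) : su11 := ⟨pauli α, by
  constructor
  · ext i j
    fin_cases α <;> fin_cases i <;> fin_cases j <;>
      simp [pauli, J, Matrix.mul_apply, Fin.sum_univ_two]
  · fin_cases α <;> simp [pauli, Matrix.trace_fin_two]⟩

instance : LieRing (su11 × ℝ) := inferInstance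
instance : LieAlgebra ℝ (su11 × ℝ) := inferInstance

/-- The swap matrix. -/
def swapMat : Matrix (Fin 2) (Fin 2) ℂ := !![0, 1; 1, 0]

lemma swap_mul_swap : swapMat * swapMat = 1 := by
  ext i j; fin_cases i <;> fin_cases j <;> simp [swapMat, Matrix.mul_apply, Fin.sum_univ_two]

lemma exp_conj_invol (K X : Matrix (Fin 2) (Fin 2) ℂ) (hK : K * K = 1) :
    NormedSpace.exp (K * X * K) = K * NormedSpace.exp X * K :=
  Matrix.exp_units_conj ⟨K, K, hK, hK⟩ X

lemma exp_mem (X : su11) :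
    (NormedSpace.exp (X : Matrix (Fin 2) (Fin 2) ℂ))ᴴ * J *
      NormedSpace.exp (X : Matrix (Fin 2) (Fin 2) ℂ) = J := by
  have h1 : (X : Matrix (Fin 2) (Fin 2) ℂ)ᴴ = J * (-(X : Matrix (Fin 2) (Fin 2) ℂ)) * J := by
    have h : (X : Matrix (Fin 2) (Fin 2) ℂ)ᴴ * J = -(J * (X : Matrix (Fin 2) (Fin 2) ℂ)) :=
      eq_neg_of_add_eq_zero_left X.2.1
    calc (X : Matrix (Fin 2) (Fin 2) ℂ)ᴴ = (X : Matrix (Fin 2) (Fin 2) ℂ)ᴴ * J * J := by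
          rw [Matrix.mul_assoc, J_mul_J, Matrix.mul_one]
      _ = _ := by rw [h]; simp
  have h2 := exp_conj_invol J (-(X : Matrix (Fin 2) (Fin 2) ℂ)) J_mul_J
  rw [← Matrix.exp_conjTranspose, h1, h2, Matrix.exp_neg]
  have hu : IsUnit (NormedSpace.exp (X : Matrix (Fin 2) (Fin 2) ℂ)) := Matrix.isUnit_exp _
  have hd := (Matrix.isUnit_iff_isUnit_det _).mp hu
  calc _ = J * (NormedSpace.exp (X : Matrix (Fin 2) (Fin 2) ℂ))⁻¹ * (J * J) *
        NormedSpace.exp (X : Matrix (Fin 2) (Fin 2) ℂ) := by simp only [Matrix.mul_assoc]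
    _ = J := by
      rw [J_mul_J, Matrix.mul_one, Matrix.mul_assoc, Matrix.nonsing_inv_mul _ hd, Matrix.mul_one]

lemma su11_entries (X : su11) :
    (X : Matrix (Fin 2) (Fin 2) ℂ)ᴴᵀ = swapMat * (X : Matrix (Fin 2) (Fin 2) ℂ) * swapMat := by
  obtain ⟨X, h, ht⟩ := X
  have h00 := congrFun (congrFun h 0) 0
  have h01 := congrFun (congrFun h 0) 1
  have h11 := congrFun (congrFun h 1) 1
  have h10 := congrFun (congrFun h 1) 0
  rw [Matrix.trace_fin_two] at ht
  simp [J, Matrix.mul_apply, Matrix.vecMul, dotProduct, Fin.sum_univ_two] at h00 h01 h11 h10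
  ext i j
  fin_cases i <;> fin_cases j <;>
    simp [swapMat, Matrix.mul_apply, Matrix.vecMul, dotProduct, Fin.sum_univ_two]
  · linear_combination h00 - ht
  · linear_combination h10
  · linear_combination -h01
  · linear_combination -h11 - ht

lemma det_exp_su11 (X : su11) :
    (NormedSpace.exp (X : Matrix (Fin 2) (Fin 2) ℂ)).det = 1 := by
  have h := exp_mem X
  have h1 := exp_conj_invol swapMat (X : Matrix (Fin 2) (Fin 2) ℂ) swap_mul_swap
  rw [← su11_entries, Matrix.exp_transpose, Matrix.exp_conjTranspose] at h1
  generalize NormedSpace.exp (X : Matrix (Fin 2) (Fin 2) ℂ) = E at *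
  have e1 := congrFun (congrFun h1 0) 0
  have e2 := congrFun (congrFun h1 0) 1
  have h00 := congrFun (congrFun h 0) 0
  have e3 := congrFun (congrFun h1 1) 0
  simp [J, swapMat, Matrix.mul_apply, Matrix.vecMul, dotProduct, Fin.sum_univ_two] at e1 e2 e3 h00
  rw [Matrix.det_fin_two]
  linear_combination h00 - E 0 0 * e1 + E 1 0 * e3

/-- The exponential map of `SU(1,1)`. -/
def expSU (X : su11) : SU11 :=
  SU11.mk (NormedSpace.exp (X : Matrix (Fin 2) (Fin 2) ℂ)) (det_exp_su11 X) (exp_mem X)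

/-- The adjoint action `Ad_A X = A X A⁻¹` of `SU(1,1)` on `su(1,1)`. -/
def adSU (A : SU11) (X : su11) : su11 :=
  ⟨A.mat * X * (A⁻¹).mat, by
    have h := A⁻¹.mat_mem
    have hA := A.mat_mem
    have e1 : (A⁻¹).mat * A.mat = 1 := by rw [← SU11.mat_mul]; simp
    have e2 : A.mat * (A⁻¹).mat = 1 := by rw [← SU11.mat_mul]; simp
    refine ⟨?_, by rw [Matrix.trace_mul_comm, ← Matrix.mul_assoc, e1, Matrix.one_mul]; exact X.2.2⟩
    have e3 : A.matᴴ * J = J * (A⁻¹).mat := by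
      calc A.matᴴ * J = A.matᴴ * J * (A.mat * (A⁻¹).mat) := by rw [e2, Matrix.mul_one]
        _ = _ := by rw [← Matrix.mul_assoc, hA]
    have e4 : (A⁻¹).matᴴ * J = J * A.mat := by
      calc (A⁻¹).matᴴ * J = (A⁻¹).matᴴ * J * ((A⁻¹).mat * A.mat) := by rw [e1, Matrix.mul_one]
        _ = _ := by rw [← Matrix.mul_assoc, h]
    have hX : (X : Matrix (Fin 2) (Fin 2) ℂ)ᴴ * J = -(J * (X : Matrix (Fin 2) (Fin 2) ℂ)) :=
      eq_neg_of_add_eq_zero_left X.2.1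
    rw [Matrix.conjTranspose_mul, Matrix.conjTranspose_mul, Matrix.mul_assoc, Matrix.mul_assoc, e3,
      ← Matrix.mul_assoc (X : Matrix (Fin 2) (Fin 2) ℂ)ᴴ, hX, Matrix.neg_mul, Matrix.mul_neg,
      Matrix.mul_assoc J, ← Matrix.mul_assoc _ J, e4]
    simp [Matrix.mul_assoc]⟩

/-- The exponential map of `SU(1,1) × ℝ`. -/
def expSUR (X : su11 × ℝ) : SU11R := (expSU X.1, Multiplicative.ofAdd X.2)

/-- The adjoint action of `SU(1,1) × ℝ` on `su(1,1) ⊕ ℝ`. -/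
def adSUR (a : SU11R) (X : su11 × ℝ) : su11 × ℝ := (adSU a.1 X.1, X.2)

/-! ### Isometric actions and reductive decompositions -/

/-- `Y` is the push-forward of `X` under the map `f`. -/
def Related (f : H31 → H31) (X Y : VField) : Prop :=
  ∀ p, Y (f p) = dif (fun q => (f q : Amb)) p (X p)

/-- Smoothness of a bijection and of its inverse. -/
def IsDiffeo (f : H31 ≃ H31) : Prop :=
  IsSmooth (fun p => (f p : Amb)) ∧ IsSmooth (fun p => (f.symm p : Amb))

/-- Isometries of `(H31, g)`. -/
def IsIsometry (g : Tensor02) (f : H31 ≃ H31) : Prop :=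
  IsDiffeo f ∧ ∀ X Y X' Y', Related f X X' → Related f Y Y' → ∀ p, g X' Y' (f p) = g X Y p

/-- Invariance of the tensor fields `S, φ, ξ, η` under a diffeomorphism. -/
structure PreservesTensors (S : Tensor12) (φ : Tensor11) (ξ : VField) (η : Form1)
    (f : H31 ≃ H31) : Prop where
  tensor : ∀ X Y X' Y', Related f X X' → Related f Y Y' → Related f (S X Y) (S X' Y')
  phi : ∀ X X', Related f X X' → Related f (φ X) (φ X')
  xi : Related f ξ ξ
  eta : ∀ X X', Related f X X' → ∀ p, η X' (f p) = η X p

section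
variable {G 𝔤 : Type*} [Group G] [MulAction G H31] [LieRing 𝔤] [LieAlgebra ℝ 𝔤]

/-- `G` acts on `(H31, g)` transitively, effectively and by isometries. -/
structure IsTransitiveEffectiveIsometric (G : Type*) [Group G] [MulAction G H31]
    (g : Tensor02) : Prop where
  transitive : ∀ p q : H31, ∃ a : G, a • p = q
  effective : ∀ a : G, (∀ p : H31, a • p = p) → a = 1
  isometric : ∀ a : G, IsIsometry g (MulAction.toPerm a)

/-- Reductive decomposition `𝔤 = 𝔥 ⊕ 𝔪` at the base point `o`, for a group `G` with exponential map
`e` and adjoint action `Ad`: `𝔥` is the Lie algebra of the isotropy group `H` at `o`, and `𝔪` is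
an `Ad(H)`-invariant complement. -/
structure IsReductiveDecomposition (e : 𝔤 → G) (Ad : G → 𝔤 → 𝔤) (h m : Submodule ℝ 𝔤) : Prop where
  compl : IsCompl h m
  isotropy : ∀ X : 𝔤, X ∈ h ↔ ∀ s : ℝ, e (s • X) ∈ MulAction.stabilizer G o
  invariant : ∀ a ∈ MulAction.stabilizer G o, ∀ X ∈ m, Ad a X ∈ m

/-- `K X` is the vector field `X^*` generated by the one-parameter group `exp(sX)`. -/
def IsFundamental (e : 𝔤 → G) (K : 𝔤 → VField) : Prop :=
  ∀ (X : 𝔤) (p : H31), HasDerivAt (fun s : ℝ => ((e (s • X) • p : H31) : Amb)) (K X p) 0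

/-- The curvature operators `R(X,Y)` of a connection at `o` generate this Lie algebra of
endomorphisms of `T_o H31`. -/
def holonomyAlgebra (D : AffineConnection) : LieSubalgebra ℝ (Module.End ℝ (tangent o)) :=
  LieSubalgebra.lieSpan ℝ _
    {U | ∃ X Y : VField, ∀ Z : VField, U (Z.at o) = (curv D X Y Z).at o}

/-- The reductive decomposition `𝔤 = 𝔥 ⊕ 𝔪` is the one induced by the homogeneous structure `S` on
`(H31, g)`, where `D` is the Levi-Civita connection of `g`. With `∇̃ = D - S`:
* `X ↦ X^*|_o` is an isomorphism from `𝔪` onto `T_o H31`;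
* `∇̃` is the canonical connection of the decomposition, `∇̃_{X^*} Y^*|_o = -([X,Y]_𝔪)^*|_o`;
* with `𝔪` identified with `T_o H31` and `𝔥` with the holonomy algebra of `∇̃`, the bracket of `𝔤`
  is `[U,V] = UV - VU`, `[U,X] = U(X)`, `[X,Y] = S_X Y - S_Y X - R̃(X,Y)`. -/
def IsInducedBy (e : 𝔤 → G) (h m : Submodule ℝ 𝔤) (D : AffineConnection) (S : Tensor12) : Prop :=
  ∃ K : 𝔤 → VField, IsFundamental e K ∧
    (∀ v : tangent o, ∃! X : m, (K X).at o = v) ∧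
    (∀ X Y W : m, ∀ V : h, ⁅(X : 𝔤), (Y : 𝔤)⁆ = V + W →
      ((D.subTensor S).nab (K X) (K Y)).at o = -(K W).at o) ∧
    ∃ κ : h →ₗ[ℝ] Module.End ℝ (tangent o), Function.Injective κ ∧
      LinearMap.range κ = (holonomyAlgebra (D.subTensor S)).toSubmodule ∧
      (∀ U V : h, ∃ W : h, (W : 𝔤) = ⁅(U : 𝔤), (V : 𝔤)⁆ ∧ κ W = κ U * κ V - κ V * κ U) ∧
      (∀ (U : h) (X : m), ∃ Y : m, (Y : 𝔤) = ⁅(U : 𝔤), (X : 𝔤)⁆ ∧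
        (K Y).at o = κ U ((K X).at o)) ∧
      ∀ X Y : m, ∃ (V : h) (W : m), ⁅(X : 𝔤), (Y : 𝔤)⁆ = V + W ∧
        ∀ X' Y' : VField, X'.at o = (K X).at o → Y'.at o = (K Y).at o →
          (K W).at o = (S X' Y' - S Y' X').at o ∧
          ∀ Z : VField, κ V (Z.at o) = -(curv (D.subTensor S) X' Y' Z).at o

end

/-- `𝔥 = span {X₁ + D}` in `su(1,1) ⊕ ℝ D`. -/
def hSub : Submodule ℝ (su11 × ℝ) := Submodule.span ℝ {(B 1, 1)}

/-- `𝔪 = span {X₀, (μ+t)/(2ν) X₁ - (2ν-μ-t)/(2ν) D, X₂}` in `su(1,1) ⊕ ℝ D`. -/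
def mSub (mu nu t : ℝ) : Submodule ℝ (su11 × ℝ) :=
  Submodule.span ℝ {(B 0, 0), (((mu + t) / (2 * nu)) • B 1, -((2 * nu - mu - t) / (2 * nu))),
    (B 2, 0)}

end AdS3

end

noncomputable section

open scoped ContDiff ComplexConjugate

attribute [local instance 100] LieRing.ofAssociativeRing

namespace AdS3

/-! ### Directional derivatives -/

/-! The module of vector fields is free on `X₀, X₁, X₂`, so every statement becomes an identity
between component functions. Derivatives enter through the Leibniz rule, the commutator rule
`dirDeriv_comm` and the brackets `[X₀,X₁] = 2X₂`, `[X₁,X₂] = -2X₀`, `[X₂,X₀] = 2X₁` (`bracket_eq`).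

Write `r = μ/ν`, `q = t/ν`, `c = r + q - 2`, and let `P` be the endomorphism exchanging `X₀` and
`X₂` and killing `X₁`. The Levi-Civita connection and the tensor `S` have explicit constant
coefficients in the frame (`leviCivita`, `homTensor`), and uniqueness of both allows one to work
with these models only. In `∇ - S` nearly everything cancels (`subTensor_nab`): it is the flat
left-invariant connection plus `c θ¹ ⊗ P`. A tensor with constant frame components is therefore
parallel as soon as the derivation `P` annihilates it. This is the case for `g` because `-λ = ν`,
and for `R`, `S`, `φ̃₁`, `ξ₁`, `η₁`.

As the connection form is a multiple of the single endomorphism `P`, the curvature is `c dθ¹ ⊗ P`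
(`curv_subTensor`), and the holonomy algebra is spanned by `cP` (`holonomyAlgebra_eq`). It is a line
when `t ≠ 2ν - μ` and zero when `t = 2ν - μ`; this is the dichotomy between the two groups.

On the group side, the action of `(A, s)` extends to a linear map of `ℂ²` which acts on the frame as
the boost of rapidity `-2s` in the plane of `X₀, X₂` (`related_toPerm_iff`), that is, as the
exponential of a multiple of `P`. So the same `P`-invariance yields isometries that preserve all the
tensors. The fundamental fields are linear too; their values and first derivatives at `o` reduce the
conditions on the reductive decomposition to linear algebra, with `𝔪` cut out by one linear equation
(`mem_mSub`). -/

lemma dirDeriv_apply (X : VField) (f : SmoothFun) (p : H31) :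
    dirDeriv X f p = dif f p (X p) := rfl

@[simp] lemma dirDeriv_add (X : VField) (f g : SmoothFun) :
    dirDeriv X (f + g) = dirDeriv X f + dirDeriv X g := by
  ext1 p
  have h := (f.smooth.differentiableAt p).hasFDerivAt.add (g.smooth.differentiableAt p).hasFDerivAt
  exact congrArg (fun L => L (X p)) h.fderiv

@[simp] lemma dirDeriv_mul (X : VField) (f g : SmoothFun) :
    dirDeriv X (f * g) = dirDeriv X f * g + f * dirDeriv X g := by
  ext1 p
  have h := (f.smooth.differentiableAt p).hasFDerivAt.mul (g.smooth.differentiableAt p).hasFDerivAt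
  have h' := congrArg (fun L => L (X p)) h.fderiv
  simp only [retr_coe] at h'
  refine h'.trans ?_
  simp [dirDeriv_apply, dif]
  ring

@[simp] lemma dirDeriv_smul (X : VField) (c : ℝ) (f : SmoothFun) :
    dirDeriv X (c • f) = c • dirDeriv X f := by
  ext1 p
  have h := (f.smooth.differentiableAt p).hasFDerivAt.const_smul c
  exact congrArg (fun L => L (X p)) h.fderiv

@[simp] lemma dirDeriv_neg (X : VField) (f : SmoothFun) : dirDeriv X (-f) = -dirDeriv X f := by
  rw [← neg_one_smul ℝ f, dirDeriv_smul, neg_one_smul]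

@[simp] lemma dirDeriv_sub (X : VField) (f g : SmoothFun) :
    dirDeriv X (f - g) = dirDeriv X f - dirDeriv X g := by
  rw [sub_eq_add_neg, dirDeriv_add, dirDeriv_neg, sub_eq_add_neg]

@[simp] lemma dirDeriv_algebraMap (X : VField) (c : ℝ) :
    dirDeriv X (algebraMap ℝ SmoothFun c) = 0 := by
  ext1 p
  change fderiv ℝ (fun _ : Amb => c) _ _ = 0
  simp

@[simp] lemma dirDeriv_zero (X : VField) : dirDeriv X 0 = 0 := by
  simpa using dirDeriv_smul X 0 0

lemma dirDeriv_add_left (X Y : VField) (f : SmoothFun) :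
    dirDeriv (X + Y) f = dirDeriv X f + dirDeriv Y f := by
  ext1 p; simp [dirDeriv_apply]

lemma dirDeriv_fsmul_left (h : SmoothFun) (X : VField) (f : SmoothFun) :
    dirDeriv (h • X) f = h * dirDeriv X f := by
  ext1 p; simp [dirDeriv_apply]

/-- Differentiating twice gives the Hessian of the extension `f ∘ retr` plus a first-order term. The
Hessian is symmetric and drops out, and the first-order terms assemble into the bracket. -/
lemma dirDeriv_comm (X Y : VField) (f : SmoothFun) :
    dirDeriv X (dirDeriv Y f) - dirDeriv Y (dirDeriv X f) = dirDeriv (bracket X Y) f := by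
  ext1 p
  have key (X Y : VField) : dirDeriv X (dirDeriv Y f) p =
      fderiv ℝ (fderiv ℝ (fun z : Amb => f (retr z))) p (X p) (Y p) +
        dif f p (dif Y p (X p)) := by
    have hF : ContDiffAt ℝ ∞ (fun z : Amb => f (retr z)) (p : Amb) :=
      f.smooth.contDiffAt (isOpen_cone.mem_nhds (coe_mem_cone p))
    have h1 : HasFDerivAt (fderiv ℝ (fun z : Amb => f (retr z)))
        (fderiv ℝ (fderiv ℝ (fun z : Amb => f (retr z))) p) ((retr (p : Amb) : H31) : Amb) := by
      rw [retr_coe]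
      exact ((hF.fderiv_right (m := 1) (by norm_cast)).differentiableAt
        (by simp)).hasFDerivAt
    have h2 := h1.comp (p : Amb) (isSmooth_coe.differentiableAt p).hasFDerivAt
    have h3 := h2.clm_apply (Y.smooth.differentiableAt p).hasFDerivAt
    have h4 := congrArg (fun L => L (X p)) h3.fderiv
    refine h4.trans ?_
    -- The derivative of `retr` enters by the chain rule; it is the identity on tangent vectors.
    have h5 := dif_coe p (X p) (X.mem p)
    simp only [dif] at h5 ⊢
    simp [retr_coe, h5]
    ring
  have hs := ((f.smooth.contDiffAt (isOpen_cone.mem_nhds (coe_mem_cone p))).isSymmSndFDerivAt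
    (by rw [minSmoothness_of_isRCLikeNormedField]; exact WithTop.coe_le_coe.2 le_top)) (X p) (Y p)
  simp only [SmoothFun.sub_apply, key]
  rw [hs]
  change _ = dif f p (dif Y p (X p) - dif X p (Y p))
  rw [map_sub]
  ring

/-! ### Components in the left-invariant frame -/

lemma coframe_apply (α : Fin 3) (X : VField) (p : H31) :
    coframe α X p = coeff p (X p) α := rfl

@[simp] lemma coframe_frame (α β : Fin 3) :
    coframe α (frame β) = if α = β then 1 else 0 := by
  have : frame β = frameBasis β := by
    change _ = ((Module.Basis.ofEquivFun _ : Module.Basis (Fin 3) SmoothFun VField)) β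
    rw [Module.Basis.coe_ofEquivFun]
    change _ = ∑ γ, (Pi.single β (1 : SmoothFun) : Fin 3 → SmoothFun) γ • frame γ
    simp
  rw [this, coframe, Module.Basis.coord_apply, Module.Basis.repr_self, Finsupp.single_apply]
  simp [eq_comm]

lemma VField.ext_coframe {X Y : VField} (h0 : coframe 0 X = coframe 0 Y)
    (h1 : coframe 1 X = coframe 1 Y) (h2 : coframe 2 X = coframe 2 Y) : X = Y := by
  refine frameBasis.ext_elem fun i => ?_
  fin_cases i
  exacts [h0, h1, h2]

lemma VField.eq_sum (X : VField) :
    X = coframe 0 X • frame 0 + coframe 1 X • frame 1 + coframe 2 X • frame 2 := by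
  apply VField.ext_coframe <;> simp

/-- The vector field with given components in the frame `X₀, X₁, X₂`. -/
def ofComponents (a b c : SmoothFun) : VField := a • frame 0 + b • frame 1 + c • frame 2

@[simp] lemma coframe_zero_ofComponents (a b c : SmoothFun) :
    coframe 0 (ofComponents a b c) = a := by simp [ofComponents]
@[simp] lemma coframe_one_ofComponents (a b c : SmoothFun) :
    coframe 1 (ofComponents a b c) = b := by simp [ofComponents]
@[simp] lemma coframe_two_ofComponents (a b c : SmoothFun) :
    coframe 2 (ofComponents a b c) = c := by simp [ofComponents]

@[simp] lemma coframe_smul (α : Fin 3) (c : ℝ) (X : VField) :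
    coframe α (c • X) = c • coframe α X := by
  rw [← algebraMap_smul SmoothFun c X, map_smul, algebraMap_smul]

lemma VField.apply_eq (X : VField) (p : H31) : X p = coframe 0 X p • rightMul 0 p +
    coframe 1 X p • rightMul 1 p + coframe 2 X p • rightMul 2 p := by
  conv_lhs => rw [X.eq_sum]
  rfl

lemma dif_linear (L : Amb →ₗ[ℝ] Amb) (p : H31) (v : Amb) (hv : v ∈ tangent p) :
    dif (fun q : H31 => L q) p v = L v := by
  have h := (LinearMap.toContinuousLinearMap L).hasFDerivAt.comp (p : Amb)
    (isSmooth_coe.differentiableAt p).hasFDerivAt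
  refine (congrArg (fun L => L v) h.fderiv).trans ?_
  exact congrArg L (dif_coe p v hv)

/-- Leibniz rule for the frame expansion of `Y`. The frame fields are restrictions of linear maps,
so their derivatives are those same maps applied to `X p`. -/
lemma dif_vfield (X Y : VField) (p : H31) : dif Y p (X p) =
    dirDeriv X (coframe 0 Y) p • rightMul 0 p + dirDeriv X (coframe 1 Y) p • rightMul 1 p +
    dirDeriv X (coframe 2 Y) p • rightMul 2 p + (coframe 0 Y p • rightMul 0 (X p) +
    coframe 1 Y p • rightMul 1 (X p) + coframe 2 Y p • rightMul 2 (X p)) := by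
  have h (α : Fin 3) := ((coframe α Y).smooth.differentiableAt p).hasFDerivAt.smul
    ((frame α).smooth.differentiableAt p).hasFDerivAt
  have h3 := congrArg (fun L => L (X p)) (((h 0).add (h 1)).add (h 2)).fderiv
  have e : (fun z : Amb => Y (retr z)) = fun z : Amb => coframe 0 Y (retr z) • frame 0 (retr z) +
      coframe 1 Y (retr z) • frame 1 (retr z) + coframe 2 Y (retr z) • frame 2 (retr z) := by
    funext z; exact Y.apply_eq (retr z)
  have e2 (α : Fin 3) := dif_linear (rightMul α) p (X p) (X.mem p)
  simp only [dif] at e2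
  rw [dif, e]
  refine h3.trans ?_
  simp [retr_coe, e2, dirDeriv_apply, dif]
  abel

/-- The terms without derivatives are commutators of right multiplications; these supply the
structure constants of `su(1,1)`. -/
lemma bracket_eq (X Y : VField) : bracket X Y = ofComponents
    (dirDeriv X (coframe 0 Y) - dirDeriv Y (coframe 0 X)
      - (2 : ℝ) • (coframe 1 X * coframe 2 Y - coframe 2 X * coframe 1 Y))
    (dirDeriv X (coframe 1 Y) - dirDeriv Y (coframe 1 X)
      + (2 : ℝ) • (coframe 2 X * coframe 0 Y - coframe 0 X * coframe 2 Y))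
    (dirDeriv X (coframe 2 Y) - dirDeriv Y (coframe 2 X)
      + (2 : ℝ) • (coframe 0 X * coframe 1 Y - coframe 1 X * coframe 0 Y)) := by
  ext1 p
  change dif Y p (X p) - dif X p (Y p) = _
  rw [dif_vfield, dif_vfield, X.apply_eq, Y.apply_eq]
  simp only [ofComponents, VField.add_apply, VField.fsmul_apply, SmoothFun.sub_apply,
    SmoothFun.add_apply, SmoothFun.mul_apply, SmoothFun.smul_apply, frame_apply]
  ext1 <;> apply Complex.ext <;> simp [rightMul, pauli] <;> ring

/-! ### The metric, its Levi-Civita connection and the homogeneous structure -/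

lemma tens_apply {M : Type*} [AddCommMonoid M] [Module SmoothFun M] (α : Form1) (T : M)
    (X : VField) : tens α T X = α X • T := rfl

lemma kkMetric_apply (lam mu nu : ℝ) (X Y : VField) (p : H31) : kkMetric lam mu nu X Y p =
    lam * (coframe 0 X p * coframe 0 Y p) + mu * (coframe 1 X p * coframe 1 Y p) +
      nu * (coframe 2 X p * coframe 2 Y p) := by
  simp [kkMetric, tens_apply]

lemma Smu_apply (mu t : ℝ) (X Y Z : VField) (p : H31) : Smu mu t X Y Z p =
    mu * (coframe 2 X p * (coframe 0 Y p * coframe 1 Z p - coframe 1 Y p * coframe 0 Z p)) +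
    mu * (coframe 0 X p * (coframe 1 Y p * coframe 2 Z p - coframe 2 Y p * coframe 1 Z p)) +
    t * (coframe 1 X p * (coframe 2 Y p * coframe 0 Z p - coframe 0 Y p * coframe 2 Z p)) := by
  simp [Smu, tens_apply, wedge]

/-- Nondegeneracy of `g_{λμν}`. -/
lemma kkMetric_nondegenerate {lam mu nu : ℝ} (hl : lam ≠ 0) (hm : mu ≠ 0) (hn : nu ≠ 0)
    {X Y : VField} (h : ∀ Z, kkMetric lam mu nu X Z = kkMetric lam mu nu Y Z) : X = Y := by
  have h' (α : Fin 3) (p : H31) := congrArg (fun f : SmoothFun => f p) (h (frame α))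
  simp only [kkMetric_apply, coframe_frame] at h'
  apply VField.ext_coframe <;> ext1 p
  · simpa [hl] using h' 0 p
  · simpa [hm] using h' 1 p
  · simpa [hn] using h' 2 p

lemma isLorentzian_kkMetric {lam mu nu : ℝ} (hl : lam < 0) (hm : 0 < mu) (hn : 0 < nu) :
    IsLorentzian (kkMetric lam mu nu) where
  symm X Y := by ext1 p; simp only [kkMetric_apply]; ring
  signature p := by
    have h0 : Real.sqrt (-lam) ^ 2 = -lam := Real.sq_sqrt (by linarith)
    have h1 : Real.sqrt mu ^ 2 = mu := Real.sq_sqrt hm.le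
    have h2 : Real.sqrt nu ^ 2 = nu := Real.sq_sqrt hn.le
    have p0 : Real.sqrt (-lam) ≠ 0 := (Real.sqrt_pos.2 (by linarith)).ne'
    have p1 : Real.sqrt mu ≠ 0 := (Real.sqrt_pos.2 hm).ne'
    have p2 : Real.sqrt nu ≠ 0 := (Real.sqrt_pos.2 hn).ne'
    refine ⟨fun i => (![Real.sqrt (-lam), Real.sqrt mu, Real.sqrt nu] i)⁻¹ • frame i,
      fun i j => ?_⟩
    fin_cases i <;> fin_cases j <;> simp [kkMetric_apply] <;> field_simp
    · linarith
    · exact h1.symm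
    · exact h2.symm

/-- The Levi-Civita connection of `g_{λμν}` for `-λ = ν` and `r = μ/ν`. -/
def leviCivita (r : ℝ) : AffineConnection where
  nab :=
    { toFun := fun X =>
        -- The coefficients are those given by the Koszul formula: `∇_{X₁}X₂ = (r-2)X₀`, `∇_{X₂}X₁ =
        -- rX₀`, `∇_{X₀}X₂ = -X₁`, `∇_{X₂}X₀ = X₁`, `∇_{X₀}X₁ = rX₂`, `∇_{X₁}X₀ = (r-2)X₂`.
        { toFun := fun Y => ofComponents
            (dirDeriv X (coframe 0 Y) + (r - 2) • (coframe 1 X * coframe 2 Y)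
              + r • (coframe 2 X * coframe 1 Y))
            (dirDeriv X (coframe 1 Y) - coframe 0 X * coframe 2 Y + coframe 2 X * coframe 0 Y)
            (dirDeriv X (coframe 2 Y) + r • (coframe 0 X * coframe 1 Y)
              + (r - 2) • (coframe 1 X * coframe 0 Y))
          map_add' := fun Y Z => by
            apply VField.ext_coframe <;> ext1 p <;> simp <;> ring
          map_smul' := fun a Y => by
            apply VField.ext_coframe <;> ext1 p <;> simp <;> ring }
      map_add' := fun X Y => by
        ext1 Z
        apply VField.ext_coframe <;> ext1 p <;> simp [dirDeriv_add_left] <;> ring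
      map_smul' := fun f X => by
        ext1 Z
        apply VField.ext_coframe <;> ext1 p <;> simp [dirDeriv_fsmul_left] <;> ring }
  leibniz X f Y := by
    apply VField.ext_coframe <;> ext1 p <;> simp <;> ring

lemma leviCivita_apply (r : ℝ) (X Y : VField) : (leviCivita r).nab X Y = ofComponents
    (dirDeriv X (coframe 0 Y) + (r - 2) • (coframe 1 X * coframe 2 Y)
      + r • (coframe 2 X * coframe 1 Y))
    (dirDeriv X (coframe 1 Y) - coframe 0 X * coframe 2 Y + coframe 2 X * coframe 0 Y)
    (dirDeriv X (coframe 2 Y) + r • (coframe 0 X * coframe 1 Y)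
      + (r - 2) • (coframe 1 X * coframe 0 Y)) := rfl

/-- The `(1,2)`-tensor field associated with `S_μ(t)` for `-λ = ν`, `r = μ/ν` and `q = t/ν`. -/
def homTensor (r q : ℝ) : Tensor12 :=
  LinearMap.mk₂ SmoothFun (fun X Y => ofComponents
      (r • (coframe 2 X * coframe 1 Y) - q • (coframe 1 X * coframe 2 Y))
      (coframe 2 X * coframe 0 Y - coframe 0 X * coframe 2 Y)
      (r • (coframe 0 X * coframe 1 Y) - q • (coframe 1 X * coframe 0 Y)))
    (fun X X' Y => by apply VField.ext_coframe <;> ext1 p <;> simp <;> ring)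
    (fun f X Y => by apply VField.ext_coframe <;> ext1 p <;> simp <;> ring)
    (fun X Y Y' => by apply VField.ext_coframe <;> ext1 p <;> simp <;> ring)
    (fun f X Y => by apply VField.ext_coframe <;> ext1 p <;> simp <;> ring)

lemma homTensor_apply (r q : ℝ) (X Y : VField) : homTensor r q X Y = ofComponents
      (r • (coframe 2 X * coframe 1 Y) - q • (coframe 1 X * coframe 2 Y))
      (coframe 2 X * coframe 0 Y - coframe 0 X * coframe 2 Y)
      (r • (coframe 0 X * coframe 1 Y) - q • (coframe 1 X * coframe 0 Y)) := rfl

lemma dirDeriv_kkMetric (lam mu nu : ℝ) (X Y Z : VField) (p : H31) :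
    dirDeriv X (kkMetric lam mu nu Y Z) p =
      lam * (dirDeriv X (coframe 0 Y) p * coframe 0 Z p
        + coframe 0 Y p * dirDeriv X (coframe 0 Z) p)
      + mu * (dirDeriv X (coframe 1 Y) p * coframe 1 Z p
        + coframe 1 Y p * dirDeriv X (coframe 1 Z) p)
      + nu * (dirDeriv X (coframe 2 Y) p * coframe 2 Z p
        + coframe 2 Y p * dirDeriv X (coframe 2 Z) p) := by
  simp [kkMetric, tens_apply]
  ring

lemma isLeviCivita_leviCivita {mu nu : ℝ} (hn : nu ≠ 0) :
    IsLeviCivita (kkMetric (-nu) mu nu) (leviCivita (mu / nu)) where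
  torsionFree X Y := by
    rw [bracket_eq]
    apply VField.ext_coframe <;> ext1 p <;> simp [leviCivita_apply] <;> ring
  metric X Y Z := by
    ext1 p
    rw [dirDeriv_kkMetric]
    simp [kkMetric_apply, leviCivita_apply]
    field_simp
    ring

/-- The difference of the two connections, lowered with `g`, is symmetric in its first two arguments
(no torsion) and skew in its last two (metricity). Alternating the two symmetries six times shows
that it equals its own negative. -/
lemma IsLeviCivita.unique {lam mu nu : ℝ} (hl : lam ≠ 0) (hm : mu ≠ 0) (hn : nu ≠ 0)
    {D D' : AffineConnection} (hD : IsLeviCivita (kkMetric lam mu nu) D)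
    (hD' : IsLeviCivita (kkMetric lam mu nu) D') : D = D' := by
  set g := kkMetric lam mu nu
  have gs (X Y : VField) : g X Y = g Y X := by ext1 p; simp only [g, kkMetric_apply]; ring
  have e1 (X Y : VField) : D.nab X Y - D'.nab X Y = D.nab Y X - D'.nab Y X := by
    have h := (hD.torsionFree X Y).trans (hD'.torsionFree X Y).symm
    rw [sub_eq_sub_iff_add_eq_add] at h ⊢
    rw [h, add_comm]
  have s (X Y Z : VField) :
      g (D.nab X Y - D'.nab X Y) Z = g (D.nab Y X - D'.nab Y X) Z := by rw [e1]
  have a (X Y Z : VField) : g (D.nab X Y - D'.nab X Y) Z = -g (D.nab X Z - D'.nab X Z) Y := by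
    have h1 := hD.metric X Y Z
    have h2 := hD'.metric X Y Z
    rw [gs Y (D.nab X Z)] at h1
    rw [gs Y (D'.nab X Z)] at h2
    simp only [map_sub, LinearMap.sub_apply]
    linear_combination h2 - h1
  have z (X Y Z : VField) : g (D.nab X Y - D'.nab X Y) Z = 0 := by
    have h : g (D.nab X Y - D'.nab X Y) Z = -g (D.nab X Y - D'.nab X Y) Z := by
      calc _ = -g (D.nab X Z - D'.nab X Z) Y := a X Y Z
        _ = -g (D.nab Z X - D'.nab Z X) Y := by rw [s]
        _ = g (D.nab Z Y - D'.nab Z Y) X := by rw [a]; simp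
        _ = g (D.nab Y Z - D'.nab Y Z) X := s _ _ _
        _ = -g (D.nab Y X - D'.nab Y X) Z := a _ _ _
        _ = _ := by rw [s]
    ext1 p
    have := congrArg (fun f : SmoothFun => f p) h
    simp only [SmoothFun.neg_apply] at this
    rw [SmoothFun.zero_apply]; linarith
  have n (X Y : VField) : D.nab X Y = D'.nab X Y :=
    kkMetric_nondegenerate hl hm hn fun Z => by
      have := z X Y Z
      rwa [map_sub, LinearMap.sub_apply, sub_eq_zero] at this
  ext1
  exact LinearMap.ext fun X => LinearMap.ext fun Y => n X Y

lemma isAssociated_homTensor {mu nu : ℝ} (hn : nu ≠ 0) (t : ℝ) :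
    IsAssociated (kkMetric (-nu) mu nu) (Smu mu t) (homTensor (mu / nu) (t / nu)) := by
  intro X Y Z
  ext1 p
  simp [Smu_apply, kkMetric_apply, homTensor_apply]
  field_simp
  ring

lemma IsAssociated.unique {lam mu nu : ℝ} (hl : lam ≠ 0) (hm : mu ≠ 0) (hn : nu ≠ 0)
    {S : Tensor03} {T T' : Tensor12} (hT : IsAssociated (kkMetric lam mu nu) S T)
    (hT' : IsAssociated (kkMetric lam mu nu) S T') : T = T' :=
  LinearMap.ext fun X => LinearMap.ext fun Y => kkMetric_nondegenerate hl hm hn fun Z => by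
    rw [← hT, ← hT']

/-- The computation on which everything rests: only the term along `θ¹` survives, with the factor `r
+ q - 2`, and it exchanges the components along `X₀` and `X₂`. -/
lemma subTensor_nab (r q : ℝ) (X Y : VField) :
    ((leviCivita r).subTensor (homTensor r q)).nab X Y = ofComponents
      (dirDeriv X (coframe 0 Y) + (r + q - 2) • (coframe 1 X * coframe 2 Y))
      (dirDeriv X (coframe 1 Y))
      (dirDeriv X (coframe 2 Y) + (r + q - 2) • (coframe 1 X * coframe 0 Y)) := by
  change (leviCivita r).nab X Y - homTensor r q X Y = _
  apply VField.ext_coframe <;> ext1 p <;> simp [leviCivita_apply, homTensor_apply] <;> ring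

/-! ### Curvature -/

lemma dirDeriv_bracket (X Y : VField) (f : SmoothFun) (p : H31) :
    dirDeriv (bracket X Y) f p = dirDeriv X (dirDeriv Y f) p - dirDeriv Y (dirDeriv X f) p := by
  rw [← dirDeriv_comm]; rfl

/-- Once all derivatives of components cancel, what remains is polynomial in the components, with
constant coefficients; this form makes the parallelism of `R` a `ring` identity. -/
lemma curv_leviCivita (r : ℝ) (X Y Z : VField) : curv (leviCivita r) X Y Z = ofComponents
    (r ^ 2 • ((coframe 1 X * coframe 0 Y - coframe 0 X * coframe 1 Y) * coframe 1 Z)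
      + (4 - 3 * r) • ((coframe 2 X * coframe 0 Y - coframe 0 X * coframe 2 Y) * coframe 2 Z))
    (r • ((coframe 1 X * coframe 0 Y - coframe 0 X * coframe 1 Y) * coframe 0 Z)
      + r • ((coframe 2 X * coframe 1 Y - coframe 1 X * coframe 2 Y) * coframe 2 Z))
    ((4 - 3 * r) • ((coframe 2 X * coframe 0 Y - coframe 0 X * coframe 2 Y) * coframe 0 Z)
      + r ^ 2 • ((coframe 1 X * coframe 2 Y - coframe 2 X * coframe 1 Y) * coframe 1 Z)) := by
  apply VField.ext_coframe <;> ext1 p <;>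
    -- The bracket must stay opaque until derivatives along it have become commutators of second
    -- derivatives; only then are its components expanded.
    simp [curv, leviCivita_apply, dirDeriv_bracket] <;>
    simp [bracket_eq] <;> ring

/-- The connection form `c θ¹ P` commutes with itself, so only its exterior derivative contributes,
and `dθ¹ = -2 θ²∧θ⁰`. -/
lemma curv_subTensor (r q : ℝ) (X Y Z : VField) :
    curv ((leviCivita r).subTensor (homTensor r q)) X Y Z = ofComponents
      ((-2 * (r + q - 2)) • ((coframe 2 X * coframe 0 Y - coframe 0 X * coframe 2 Y)
        * coframe 2 Z)) 0
      ((-2 * (r + q - 2)) • ((coframe 2 X * coframe 0 Y - coframe 0 X * coframe 2 Y)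
        * coframe 0 Z)) := by
  apply VField.ext_coframe <;> ext1 p <;>
    simp [curv, subTensor_nab, dirDeriv_bracket] <;>
    simp [bracket_eq] <;> ring

/-! ### The paraSasakian and the homogeneous structure -/

/-- The normalising factors cancel because `√|λ| = √ν`; hence `φ̃₁ = -P`. -/
lemma phi1_apply {mu nu : ℝ} (hn : 0 < nu) (X : VField) : phi1 (-nu) mu nu X =
    ofComponents (-coframe 2 X) 0 (-coframe 0 X) := by
  have h : Real.sqrt nu ≠ 0 := (Real.sqrt_pos.2 hn).ne'
  apply VField.ext_coframe <;> ext1 p <;>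
    simp [phi1, tens_apply, unitFrame, unitCoframe, frameLength, abs_of_pos hn] <;> field_simp

lemma coframe_xi1 (lam mu nu : ℝ) (α : Fin 3) :
    coframe α (xi1 lam mu nu) = if α = 1 then algebraMap ℝ SmoothFun (Real.sqrt mu)⁻¹ else 0 := by
  ext1 p
  fin_cases α <;> simp [xi1, unitFrame, frameLength]

lemma eta1_apply (lam mu nu : ℝ) (X : VField) :
    eta1 lam mu nu X = Real.sqrt mu • coframe 1 X := rfl

lemma isAlmostParacontactMetric {mu nu : ℝ} (hm : 0 < mu) (hn : 0 < nu) :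
    IsAlmostParacontactMetric (kkMetric (-nu) mu nu) (phi1 (-nu) mu nu) (xi1 (-nu) mu nu)
      (eta1 (-nu) mu nu) := by
  have h : Real.sqrt mu ≠ 0 := (Real.sqrt_pos.2 hm).ne'
  have h1 : Real.sqrt mu ^ 2 = mu := Real.sq_sqrt hm.le
  constructor
  · intro X
    apply VField.ext_coframe <;> ext1 p <;>
      simp [phi1_apply hn, eta1_apply, coframe_xi1]
    field_simp; ring
  · ext1 p
    simp [eta1_apply, coframe_xi1, h]
  · intro X Y
    ext1 p
    simp [phi1_apply hn, eta1_apply, kkMetric_apply]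
    linear_combination (-coframe 1 X p * coframe 1 Y p) * h1

lemma isParaSasakian {mu nu : ℝ} (hm : 0 < mu) (hn : 0 < nu) :
    IsParaSasakian (kkMetric (-nu) mu nu) (leviCivita (mu / nu)) (phi1 (-nu) mu nu)
      (xi1 (-nu) mu nu) (eta1 (-nu) mu nu) (algebraMap ℝ SmoothFun (-(Real.sqrt mu / nu))) where
  toIsAlmostParacontactMetric := isAlmostParacontactMetric hm hn
  cov X Y := by
    -- With `μ = s²` the claim becomes a rational identity in `s` and `ν`.
    obtain ⟨s, hs, rfl⟩ : ∃ s, 0 < s ∧ s ^ 2 = mu := ⟨_, Real.sqrt_pos.2 hm, Real.sq_sqrt hm.le⟩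
    have e := Real.sqrt_sq hs.le
    apply VField.ext_coframe <;> ext1 p <;>
      simp [covDeriv11, phi1_apply hn, eta1_apply, kkMetric_apply, coframe_xi1,
        leviCivita_apply, e] <;> field_simp <;> ring

lemma isHomogeneousAlmostParacontactMetric {mu nu : ℝ} (hm : 0 < mu) (hn : 0 < nu) (t : ℝ) :
    IsHomogeneousAlmostParacontactMetric (kkMetric (-nu) mu nu) (leviCivita (mu / nu))
      (homTensor (mu / nu) (t / nu)) (phi1 (-nu) mu nu) (xi1 (-nu) mu nu)
      (eta1 (-nu) mu nu) where
  toIsAlmostParacontactMetric := isAlmostParacontactMetric hm hn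
  metric X Y Z := by
    ext1 p
    simp only [SmoothFun.sub_apply, dirDeriv_kkMetric]
    simp [kkMetric_apply, subTensor_nab]
    ring
  curvature X Y Z W := by
    apply VField.ext_coframe <;> ext1 p <;>
      simp [curv_leviCivita, subTensor_nab] <;> ring
  tensor X Y Z := by
    apply VField.ext_coframe <;> ext1 p <;>
      simp [homTensor_apply, subTensor_nab] <;> ring
  parallel_phi X Y := by
    apply VField.ext_coframe <;> ext1 p <;>
      simp [covDeriv11, phi1_apply hn, subTensor_nab] <;> ring
  parallel_xi X := by
    apply VField.ext_coframe <;> ext1 p <;>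
      simp [coframe_xi1, subTensor_nab]
  parallel_eta X Y := by
    ext1 p
    simp [covDeriv1, eta1_apply, subTensor_nab]

/-! ### The group actions -/

/-- Compare `X` with the field having constant components `a, b, c`: components at `p` depend only
on the value at `p`. -/
lemma coframe_eq_of_apply_eq (X : VField) (p : H31) (a b c : ℝ)
    (h : X p = a • rightMul 0 p + b • rightMul 1 p + c • rightMul 2 p) :
    coframe 0 X p = a ∧ coframe 1 X p = b ∧ coframe 2 X p = c := by
  set Y := ofComponents (algebraMap ℝ SmoothFun a) (algebraMap ℝ SmoothFun b)
    (algebraMap ℝ SmoothFun c)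
  have e : X p = Y p := h
  simp only [coframe_apply, e]
  simp only [← coframe_apply]
  simp [Y]

/-- The linear extension to `ℂ²` of the action of an element of `SU(1,1) × ℝ`. -/
def actionLin (a : SU11R) : Amb →ₗ[ℝ] Amb where
  toFun z :=
    ((a.1.mat 0 0 * z.1 + a.1.mat 0 1 * conj z.2) * Real.cosh a.2.toAdd
      - (a.1.mat 0 0 * z.2 + a.1.mat 0 1 * conj z.1) * Real.sinh a.2.toAdd,
    -((a.1.mat 0 0 * z.1 + a.1.mat 0 1 * conj z.2) * Real.sinh a.2.toAdd)
      + (a.1.mat 0 0 * z.2 + a.1.mat 0 1 * conj z.1) * Real.cosh a.2.toAdd)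
  map_add' z w := by ext1 <;> simp <;> ring
  map_smul' c z := by ext1 <;> simp <;> ring

lemma smul_coe (a : SU11R) (p : H31) : ((a • p : H31) : Amb) = actionLin a p := by
  change ((toSU.symm (a.1 * toSU p * hopf a.2.toAdd) : H31) : Amb) = _
  ext1
  · simp [toSU, SU11.mat_mul, hopf, actionLin, Matrix.mul_apply, Fin.sum_univ_two]; ring
  · simp [toSU, SU11.mat_mul, hopf, actionLin, Matrix.mul_apply, Fin.sum_univ_two]

/-- Left multiplication commutes with right multiplication, so only conjugation of `X_α` by `hopf s`
matters. It fixes `X₁` and boosts the pair `X₀, X₂`, with doubled parameter. -/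
lemma actionLin_rightMul (a : SU11R) (z : Amb) :
    actionLin a (rightMul 0 z) = Real.cosh (2 * a.2.toAdd) • rightMul 0 (actionLin a z)
      - Real.sinh (2 * a.2.toAdd) • rightMul 2 (actionLin a z) ∧
    actionLin a (rightMul 1 z) = rightMul 1 (actionLin a z) ∧
    actionLin a (rightMul 2 z) = Real.cosh (2 * a.2.toAdd) • rightMul 2 (actionLin a z)
      - Real.sinh (2 * a.2.toAdd) • rightMul 0 (actionLin a z) := by
  have h : (Real.cosh a.2.toAdd : ℂ) ^ 2 - (Real.sinh a.2.toAdd : ℂ) ^ 2 = 1 := by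
    exact_mod_cast Real.cosh_sq_sub_sinh_sq a.2.toAdd
  rw [Real.cosh_two_mul, Real.sinh_two_mul]
  obtain ⟨A, s⟩ := a
  simp only [actionLin, LinearMap.coe_mk, AddHom.coe_mk] at h ⊢
  generalize Real.cosh s.toAdd = x at *
  generalize Real.sinh s.toAdd = y at *
  generalize A.mat 0 0 = α
  generalize A.mat 0 1 = β
  obtain ⟨z, w⟩ := z
  refine ⟨?_, ?_, ?_⟩
  · ext1
    · simp [rightMul, pauli]
      linear_combination (-Complex.I * (x * (α * z + β * conj w) + y * (α * w + β * conj z))) * h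
    · simp [rightMul, pauli]
      linear_combination (Complex.I * (y * (α * z + β * conj w) + x * (α * w + β * conj z))) * h
  · ext1 <;> simp [rightMul, pauli] <;> ring
  · ext1
    · simp [rightMul, pauli]
      linear_combination (Complex.I * (x * (α * w + β * conj z) + y * (α * z + β * conj w))) * h
    · simp [rightMul, pauli]
      linear_combination (-Complex.I * (x * (α * z + β * conj w) + y * (α * w + β * conj z))) * h

lemma dif_smul (a : SU11R) (p : H31) (v : Amb) (hv : v ∈ tangent p) :
    dif (fun q : H31 => ((MulAction.toPerm a q : H31) : Amb)) p v = actionLin a v := by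
  rw [← dif_linear (actionLin a) p v hv]
  exact congrArg (fun f : H31 → Amb => dif f p v) (funext fun q => smul_coe a q)

/-- In the left-invariant frame, the differential of the action of `(A, s)` is a boost. -/
lemma related_toPerm_iff (a : SU11R) (X Y : VField) : Related (MulAction.toPerm a) X Y ↔ ∀ p,
    coframe 0 Y (a • p) = Real.cosh (2 * a.2.toAdd) * coframe 0 X p
      - Real.sinh (2 * a.2.toAdd) * coframe 2 X p ∧
    coframe 1 Y (a • p) = coframe 1 X p ∧
    coframe 2 Y (a • p) = Real.cosh (2 * a.2.toAdd) * coframe 2 X p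
      - Real.sinh (2 * a.2.toAdd) * coframe 0 X p := by
  have key (p : H31) : actionLin a (X p) =
      (Real.cosh (2 * a.2.toAdd) * coframe 0 X p
        - Real.sinh (2 * a.2.toAdd) * coframe 2 X p) • rightMul 0 ((a • p : H31) : Amb) +
      coframe 1 X p • rightMul 1 ((a • p : H31) : Amb) +
      (Real.cosh (2 * a.2.toAdd) * coframe 2 X p
        - Real.sinh (2 * a.2.toAdd) * coframe 0 X p) • rightMul 2 ((a • p : H31) : Amb) := by
    obtain ⟨h0, h1, h2⟩ := actionLin_rightMul a p
    rw [X.apply_eq p, map_add, map_add, map_smul, map_smul, map_smul, h0, h1, h2, smul_coe]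
    module
  unfold Related
  refine forall_congr' fun p => ?_
  rw [dif_smul a p _ (X.mem p), MulAction.toPerm_apply, key]
  constructor
  · exact coframe_eq_of_apply_eq Y (a • p) _ _ _
  · rintro ⟨h0, h1, h2⟩
    rw [Y.apply_eq, h0, h1, h2]

lemma isDiffeo_toPerm (a : SU11R) : IsDiffeo (MulAction.toPerm a) := by
  have h (a : SU11R) : IsSmooth (fun p : H31 => ((a • p : H31) : Amb)) := by
    simp only [smul_coe]
    exact isSmooth_linear (actionLin a)
  exact ⟨h a, h a⁻¹⟩

lemma isIsometry_toPerm (mu nu : ℝ) (a : SU11R) :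
    IsIsometry (kkMetric (-nu) mu nu) (MulAction.toPerm a) := by
  refine ⟨isDiffeo_toPerm a, fun X Y X' Y' hX hY p => ?_⟩
  obtain ⟨x0, x1, x2⟩ := (related_toPerm_iff a X X').1 hX p
  obtain ⟨y0, y1, y2⟩ := (related_toPerm_iff a Y Y').1 hY p
  rw [MulAction.toPerm_apply, kkMetric_apply, kkMetric_apply, x0, x1, x2, y0, y1, y2]
  linear_combination (-nu * coframe 0 X p * coframe 0 Y p + nu * coframe 2 X p * coframe 2 Y p) *
    Real.cosh_sq_sub_sinh_sq (2 * a.2.toAdd)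

/-- All components are constant and boost-invariant. The identity `cosh² - sinh² = 1` is needed only
for the `X₁`-component of `S`; the other identities are linear in the hyperbolic functions. -/
lemma preservesTensors_toPerm {nu : ℝ} (hn : 0 < nu) (mu r q : ℝ) (a : SU11R) :
    PreservesTensors (homTensor r q) (phi1 (-nu) mu nu) (xi1 (-nu) mu nu) (eta1 (-nu) mu nu)
      (MulAction.toPerm a) where
  tensor X Y X' Y' hX hY := by
    rw [related_toPerm_iff] at *
    intro p
    obtain ⟨x0, x1, x2⟩ := hX p
    obtain ⟨y0, y1, y2⟩ := hY p
    simp only [homTensor_apply, coframe_zero_ofComponents, coframe_one_ofComponents,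
      coframe_two_ofComponents, SmoothFun.sub_apply, SmoothFun.smul_apply, SmoothFun.mul_apply,
      x0, x1, x2, y0, y1, y2]
    refine ⟨by ring, ?_, by ring⟩
    linear_combination (coframe 2 X p * coframe 0 Y p - coframe 0 X p * coframe 2 Y p) *
      Real.cosh_sq_sub_sinh_sq (2 * a.2.toAdd)
  phi X X' hX := by
    rw [related_toPerm_iff] at *
    intro p
    obtain ⟨x0, x1, x2⟩ := hX p
    simp only [phi1_apply hn, coframe_zero_ofComponents, coframe_one_ofComponents,
      coframe_two_ofComponents, SmoothFun.neg_apply, SmoothFun.zero_apply, x0, x2]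
    exact ⟨by ring, trivial, by ring⟩
  xi := by
    rw [related_toPerm_iff]
    intro p
    simp [coframe_xi1]
  eta X X' hX p := by
    rw [related_toPerm_iff] at hX
    simp only [eta1_apply, SmoothFun.smul_apply, MulAction.toPerm_apply, (hX p).2.1]

/-- Treats `SU(1,1)` as the slice `s = 0`, so that its properties follow from those of the larger
group. -/
lemma SU11_smul_eq (A : SU11) (p : H31) : A • p = ((A, 1) : SU11R) • p := by
  change _ = toSU.symm (A * toSU p * hopf 0)
  rw [hopf_zero, mul_one]
  rfl

lemma toPerm_SU11_eq (A : SU11) : (MulAction.toPerm A : H31 ≃ H31) =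
    MulAction.toPerm ((A, 1) : SU11R) :=
  Equiv.ext fun p => SU11_smul_eq A p

/-! ### Transitivity, effectiveness and the isotropy group of `o`. -/

lemma isTransitiveEffectiveIsometric_SU11 (mu nu : ℝ) :
    IsTransitiveEffectiveIsometric SU11 (kkMetric (-nu) mu nu) where
  transitive p q := ⟨toSU q * (toSU p)⁻¹, by
    change toSU.symm (toSU q * (toSU p)⁻¹ * toSU p) = q
    simp⟩
  effective a h := by
    have h1 : toSU.symm (a * toSU o) = o := h o
    rw [Equiv.symm_apply_eq] at h1
    exact mul_eq_right.1 h1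
  isometric a := by
    rw [toPerm_SU11_eq]
    exact isIsometry_toPerm mu nu _

lemma toSU_o : toSU o = 1 := by
  ext i j
  fin_cases i <;> fin_cases j <;> simp [toSU, o]

lemma smul_o_eq_iff (a : SU11R) : a • o = o ↔ a.1 = hopf (-a.2.toAdd) := by
  change toSU.symm (a.1 * toSU o * hopf a.2.toAdd) = o ↔ _
  have h : hopf (-a.2.toAdd) = (hopf a.2.toAdd)⁻¹ := by
    rw [eq_inv_iff_mul_eq_one, ← hopf_add, neg_add_cancel, hopf_zero]
  rw [Equiv.symm_apply_eq, toSU_o, mul_one, h, eq_inv_iff_mul_eq_one]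

lemma isTransitiveEffectiveIsometric_SU11R (mu nu : ℝ) :
    IsTransitiveEffectiveIsometric SU11R (kkMetric (-nu) mu nu) where
  transitive p q := by
    obtain ⟨A, hA⟩ := (isTransitiveEffectiveIsometric_SU11 mu nu).transitive p q
    exact ⟨(A, 1), by rw [← SU11_smul_eq, hA]⟩
  effective a h := by
    have h1 := (smul_o_eq_iff a).1 (h o)
    -- An element fixing `o` acts as conjugation by `hopf (-s)`. At `(i, 0)` the second coordinate
    -- of the image is `-2i cosh s sinh s`, which vanishes only for `s = 0`.
    let p : H31 := ⟨(Complex.I, 0), by simp [H31Set, quad]⟩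
    have h2 := congrArg (fun q : H31 => (q : Amb).2) (h p)
    simp only [smul_coe, actionLin, h1] at h2
    have hs : a.2.toAdd = 0 := by
      have h3 := congrArg Complex.im h2
      simp [p, hopf, -Complex.ofReal_sinh, -Complex.ofReal_cosh] at h3
      have h4 : Real.cosh a.2.toAdd * Real.sinh a.2.toAdd = 0 := by linarith
      rcases mul_eq_zero.1 h4 with h5 | h5
      · exact absurd h5 (Real.cosh_pos _).ne'
      · exact Real.sinh_eq_zero.1 h5
    refine Prod.ext ?_ ?_
    · rw [h1, hs, neg_zero, hopf_zero]; rfl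
    · exact Multiplicative.toAdd.injective hs
  isometric a := isIsometry_toPerm mu nu a

/-! ### Coordinates on `su(1,1)` and the exponential map -/

/-- The coordinates of an element of `su(1,1)` in the basis `X₀, X₁, X₂`. -/
def coord (α : Fin 3) : su11 →ₗ[ℝ] ℝ where
  toFun X := ![((X : Matrix (Fin 2) (Fin 2) ℂ) 0 0).im, ((X : Matrix (Fin 2) (Fin 2) ℂ) 0 1).re,
    ((X : Matrix (Fin 2) (Fin 2) ℂ) 0 1).im] α
  map_add' X Y := by fin_cases α <;> simp
  map_smul' c X := by fin_cases α <;> simp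

lemma coord_zero (X : su11) : coord 0 X = ((X : Matrix (Fin 2) (Fin 2) ℂ) 0 0).im := rfl
lemma coord_one (X : su11) : coord 1 X = ((X : Matrix (Fin 2) (Fin 2) ℂ) 0 1).re := rfl
lemma coord_two (X : su11) : coord 2 X = ((X : Matrix (Fin 2) (Fin 2) ℂ) 0 1).im := rfl

@[simp] lemma coord_B (α β : Fin 3) : coord α (B β) = if α = β then 1 else 0 := by
  fin_cases α <;> fin_cases β <;> simp [coord, B, pauli]

lemma su11_coe_eq (X : su11) : (X : Matrix (Fin 2) (Fin 2) ℂ) =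
    !![coord 0 X * Complex.I, coord 1 X + coord 2 X * Complex.I;
      coord 1 X - coord 2 X * Complex.I, -(coord 0 X * Complex.I)] := by
  have h := su11_entries X
  have h10 := congrFun (congrFun h 1) 0
  have h00 := congrFun (congrFun h 0) 0
  simp [swapMat, Matrix.mul_apply, Matrix.vecMul, dotProduct, Fin.sum_univ_two] at h10 h00
  have ht := X.2.2
  rw [Matrix.trace_fin_two] at ht
  ext i j
  fin_cases i <;> fin_cases j <;> apply Complex.ext <;>
    simp [coord_zero, coord_one, coord_two]
  · have := congrArg Complex.re (h00.trans (eq_neg_of_add_eq_zero_right ht))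
    simp at this
    linarith
  · simpa using congrArg Complex.re h10
  · have := congrArg Complex.im h10
    simp at this
    linarith
  · have h1 := congrArg Complex.re h00
    have h2 := congrArg Complex.re ht
    simp at h1 h2
    linarith
  · have := congrArg Complex.im ht
    simp at this
    linarith

lemma su11_ext {X Y : su11} (h0 : coord 0 X = coord 0 Y) (h1 : coord 1 X = coord 1 Y)
    (h2 : coord 2 X = coord 2 Y) : X = Y := by
  apply Subtype.ext
  rw [su11_coe_eq X, su11_coe_eq Y, h0, h1, h2]

lemma coord_lie (X Y : su11) :
    coord 0 ⁅X, Y⁆ = -2 * (coord 1 X * coord 2 Y - coord 2 X * coord 1 Y) ∧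
    coord 1 ⁅X, Y⁆ = 2 * (coord 2 X * coord 0 Y - coord 0 X * coord 2 Y) ∧
    coord 2 ⁅X, Y⁆ = 2 * (coord 0 X * coord 1 Y - coord 1 X * coord 0 Y) := by
  have h : ((⁅X, Y⁆ : su11) : Matrix (Fin 2) (Fin 2) ℂ) =
    (X : Matrix (Fin 2) (Fin 2) ℂ) * Y - (Y : Matrix (Fin 2) (Fin 2) ℂ) * X := rfl
  rw [coord_zero ⁅X, Y⁆, coord_one ⁅X, Y⁆, coord_two ⁅X, Y⁆, h, su11_coe_eq X, su11_coe_eq Y]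
  refine ⟨?_, ?_, ?_⟩ <;> simp <;> ring

lemma hasDerivAt_exp_entry (X : Matrix (Fin 2) (Fin 2) ℂ) (i j : Fin 2) :
    HasDerivAt (fun s : ℝ => (NormedSpace.exp (s • X) : Matrix (Fin 2) (Fin 2) ℂ) i j)
      (X i j) 0 := by
  -- Any submultiplicative norm serves to differentiate the exponential; the entrywise conclusion
  -- does not depend on it.
  let : NormedRing (Matrix (Fin 2) (Fin 2) ℂ) := Matrix.linftyOpNormedRing
  let : NormedAlgebra ℝ (Matrix (Fin 2) (Fin 2) ℂ) := Matrix.linftyOpNormedAlgebra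
  have h := hasDerivAt_exp_smul_const (𝕂 := ℝ) X (0 : ℝ)
  simp only [zero_smul, NormedSpace.exp_zero, one_mul] at h
  exact (hasDerivAt_pi.1 ((hasDerivAt_pi.1 h) i)) j

/-- Diagonalise `X₁`: eigenvalues `±1` on `(1, ±1)`. The sign is what makes `X₁ + D`, rather than
`X₁ - D`, generate the isotropy group. -/
lemma expSU_smul_B_one (s : ℝ) : expSU (s • B 1) = hopf (-s) := by
  apply SU11.ext
  let P : Matrix (Fin 2) (Fin 2) ℂ := !![1, 1; 1, -1]
  let Q : Matrix (Fin 2) (Fin 2) ℂ := !![1 / 2, 1 / 2; 1 / 2, -(1 / 2)]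
  have hPQ : P * Q = 1 := by
    ext i j; fin_cases i <;> fin_cases j <;> simp [P, Q, Matrix.mul_apply] <;> norm_num
  have hQP : Q * P = 1 := by
    ext i j; fin_cases i <;> fin_cases j <;> simp [P, Q, Matrix.mul_apply] <;> norm_num
  have h := Matrix.exp_units_conj ⟨P, Q, hPQ, hQP⟩ (Matrix.diagonal ![(s : ℂ), -(s : ℂ)])
  have e : P * Matrix.diagonal ![(s : ℂ), -(s : ℂ)] * Q =
      ((s • B 1 : su11) : Matrix (Fin 2) (Fin 2) ℂ) := by
    ext i j; fin_cases i <;> fin_cases j <;>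
      simp [P, Q, Matrix.mul_apply, Matrix.vecMul_diagonal, B, pauli] <;> ring
  change NormedSpace.exp (P * Matrix.diagonal ![(s : ℂ), -(s : ℂ)] * Q) =
    P * NormedSpace.exp (Matrix.diagonal ![(s : ℂ), -(s : ℂ)]) * Q at h
  rw [e, Matrix.exp_diagonal] at h
  change NormedSpace.exp ((s • B 1 : su11) : Matrix (Fin 2) (Fin 2) ℂ) = _
  rw [h]
  have hv : NormedSpace.exp ![(s : ℂ), -(s : ℂ)] = ![Complex.exp s, Complex.exp (-s)] := by
    funext i
    rw [Pi.coe_exp, ← Complex.exp_eq_exp_ℂ]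
    fin_cases i <;> rfl
  rw [hv]
  ext i j
  fin_cases i <;> fin_cases j <;>
    simp [P, Q, Matrix.mul_apply, Matrix.vecMul_diagonal, hopf, Complex.cosh, Complex.sinh] <;> ring

/-! ### Fundamental vector fields -/

/-- The linear extension to `ℂ²` of the fundamental vector field of `(X, d)`. -/
def fundamentalLin (U : su11 × ℝ) : Amb →ₗ[ℝ] Amb where
  toFun z :=
    ((U.1 : Matrix (Fin 2) (Fin 2) ℂ) 0 0 * z.1 + (U.1 : Matrix (Fin 2) (Fin 2) ℂ) 0 1 * conj z.2
      - U.2 * z.2,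
    (U.1 : Matrix (Fin 2) (Fin 2) ℂ) 0 0 * z.2 + (U.1 : Matrix (Fin 2) (Fin 2) ℂ) 0 1 * conj z.1
      - U.2 * z.1)
  map_add' z w := by ext1 <;> simp <;> ring
  map_smul' c z := by ext1 <;> simp <;> ring

lemma fundamentalLin_mem (U : su11 × ℝ) (p : H31) : fundamentalLin U p ∈ tangent p := by
  rw [mem_tangent]
  simp only [fundamentalLin, su11_coe_eq U.1]
  simp [bil]
  ring

/-- The fundamental vector field of `(X, d)` for the action of `SU(1,1) × ℝ`. -/
def fundamental : su11 × ℝ →ₗ[ℝ] VField where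
  toFun U := ⟨fun p => fundamentalLin U p, fundamentalLin_mem U,
    isSmooth_linear (fundamentalLin U)⟩
  map_add' U V := by
    ext1 p
    change fundamentalLin (U + V) p = fundamentalLin U p + fundamentalLin V p
    ext1 <;> simp [fundamentalLin] <;> ring
  map_smul' c U := by
    ext1 p
    change fundamentalLin (c • U) p = c • fundamentalLin U p
    ext1 <;> simp [fundamentalLin] <;> ring

lemma fundamental_apply (U : su11 × ℝ) (p : H31) : fundamental U p = fundamentalLin U p := rfl

lemma isFundamental_expSUR : IsFundamental expSUR fundamental := by
  intro U p
  have hE (i j : Fin 2) : HasDerivAt (fun s : ℝ => (expSU (s • U.1)).mat i j)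
      ((U.1 : Matrix (Fin 2) (Fin 2) ℂ) i j) 0 := hasDerivAt_exp_entry U.1 i j
  have hl : HasDerivAt (fun s : ℝ => s * U.2) U.2 0 := by
    simpa using (hasDerivAt_id (0 : ℝ)).mul_const U.2
  have hc := (hl.cosh).ofReal_comp
  have hs := (hl.sinh).ofReal_comp
  have h1 := ((((hE 0 0).mul_const (p : Amb).1).add ((hE 0 1).mul_const (conj (p : Amb).2))).mul
    hc).sub ((((hE 0 0).mul_const (p : Amb).2).add ((hE 0 1).mul_const (conj (p : Amb).1))).mul hs)
  have h2 := ((((hE 0 0).mul_const (p : Amb).1).add ((hE 0 1).mul_const (conj (p : Amb).2))).mul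
    hs).neg.add
    ((((hE 0 0).mul_const (p : Amb).2).add ((hE 0 1).mul_const (conj (p : Amb).1))).mul hc)
  have h0 : (expSU (0 : su11)).mat = 1 := by
    change NormedSpace.exp (0 : Matrix (Fin 2) (Fin 2) ℂ) = 1
    exact NormedSpace.exp_zero
  have h := h1.prodMk h2
  have e : (fun s : ℝ => ((expSUR (s • U) • p : H31) : Amb)) =
      fun s : ℝ => actionLin (expSUR (s • U)) p := funext fun s => smul_coe _ _
  rw [e]
  refine h.congr_deriv ?_
  rw [fundamental_apply]
  ext1 <;> simp [fundamentalLin, h0] <;> ring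

lemma isFundamental_expSU : IsFundamental expSU (fun X => fundamental (X, 0)) := by
  intro X p
  have h := isFundamental_expSUR (X, 0) p
  convert h using 2 with s
  rw [SU11_smul_eq]
  simp [expSUR]

lemma coe_o : (o : Amb) = (1, 0) := rfl

/-- At `o` the generator `D` of the central factor has the value `-X₁`, whence the difference in the
middle component. -/
lemma fundamental_o (U : su11 × ℝ) : coframe 0 (fundamental U) o = coord 0 U.1 ∧
    coframe 1 (fundamental U) o = coord 1 U.1 - U.2 ∧
    coframe 2 (fundamental U) o = coord 2 U.1 := by
  refine coframe_eq_of_apply_eq _ _ _ _ _ ?_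
  rw [fundamental_apply]
  simp only [fundamentalLin, su11_coe_eq U.1]
  ext1 <;> apply Complex.ext <;> simp [o, rightMul, pauli]

lemma VField.at_o_eq_iff (X Y : VField) : X.at o = Y.at o ↔ coframe 0 X o = coframe 0 Y o ∧
    coframe 1 X o = coframe 1 Y o ∧ coframe 2 X o = coframe 2 Y o := by
  constructor
  · intro h
    have h' : X o = Y o := congrArg Subtype.val h
    simp only [coframe_apply, h', and_self]
  · rintro ⟨h0, h1, h2⟩
    apply Subtype.ext
    change X o = Y o
    rw [X.apply_eq, Y.apply_eq, h0, h1, h2]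

/-- A constant orbit has zero velocity, so the fundamental field of `U` vanishes at `o`. -/
lemma fundamental_eq_zero_of_stabilizer {U : su11 × ℝ}
    (h : ∀ s : ℝ, expSUR (s • U) • o = o) :
    coord 0 U.1 = 0 ∧ coord 1 U.1 = U.2 ∧ coord 2 U.1 = 0 := by
  have h1 := isFundamental_expSUR U o
  simp only [h] at h1
  have h2 := h1.unique (hasDerivAt_const _ _)
  obtain ⟨e0, e1, e2⟩ := coframe_eq_of_apply_eq (fundamental U) o 0 0 0 (by simpa using h2)
  obtain ⟨k0, k1, k2⟩ := fundamental_o U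
  exact ⟨by linarith, by linarith, by linarith⟩

/-- The derivatives at `o` of the components of a fundamental vector field. -/
lemma dirDeriv_fundamental_o (X : VField) (U : su11 × ℝ) :
    dirDeriv X (coframe 0 (fundamental U)) o =
      2 * (coframe 1 X o * coord 2 U.1 - coframe 2 X o * coord 1 U.1) ∧
    dirDeriv X (coframe 1 (fundamental U)) o =
      -2 * (coframe 2 X o * coord 0 U.1 - coframe 0 X o * coord 2 U.1) ∧
    dirDeriv X (coframe 2 (fundamental U)) o =
      -2 * (coframe 0 X o * coord 1 U.1 - coframe 1 X o * coord 0 U.1) := by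
  have h1 := dif_vfield X (fundamental U) o
  -- The derivative is known by linearity; equating it with the frame expansion of `dif_vfield`
  -- determines the derivatives of the components.
  have h2 : dif (fundamental U) o (X o) = fundamentalLin U (X o) :=
    dif_linear (fundamentalLin U) o _ (X.mem o)
  obtain ⟨e0, e1, e2⟩ := fundamental_o U
  rw [h2, e0, e1, e2, X.apply_eq o] at h1
  simp only [fundamentalLin, su11_coe_eq U.1] at h1
  have a1 := congrArg (fun z : Amb => z.1.im) h1
  have a2 := congrArg (fun z : Amb => z.2.re) h1
  have a3 := congrArg (fun z : Amb => z.2.im) h1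
  simp [coe_o, rightMul, pauli] at a1 a2 a3
  refine ⟨by linarith, by linarith, by linarith⟩

/-! ### The reductive decompositions -/

lemma mem_hSub {U : su11 × ℝ} :
    U ∈ hSub ↔ coord 0 U.1 = 0 ∧ coord 1 U.1 = U.2 ∧ coord 2 U.1 = 0 := by
  rw [hSub, Submodule.mem_span_singleton]
  constructor
  · rintro ⟨k, rfl⟩
    simp
  · rintro ⟨h0, h1, h2⟩
    refine ⟨U.2, Prod.ext ?_ (by simp)⟩
    apply su11_ext <;> simp [h0, h1, h2]

/-- Describing `𝔪` as the kernel of one linear form turns every later membership check into a scalar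
identity. -/
lemma mem_mSub {mu nu t : ℝ} (hn : nu ≠ 0) {U : su11 × ℝ} : U ∈ mSub mu nu t ↔
    (2 - (mu / nu + t / nu)) * coord 1 U.1 + (mu / nu + t / nu) * U.2 = 0 := by
  rw [mSub, Submodule.mem_span_triple]
  constructor
  · rintro ⟨a, b, c, rfl⟩
    simp
    field_simp
    ring
  · intro h
    -- In the middle spanning vector the `X₁`-coefficient minus the `D`-coefficient is `1`, so this
    -- difference recovers its multiplier.
    refine ⟨coord 0 U.1, coord 1 U.1 - U.2, coord 2 U.1, Prod.ext ?_ ?_⟩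
    · apply su11_ext <;> simp
      field_simp at h ⊢
      linear_combination -h
    · simp
      field_simp at h ⊢
      linear_combination -h

/-- Gives the `Ad(H)`-invariance of `𝔪`, whose equation involves only the `X₁`- and `D`-coordinates.
-/
lemma coord_one_adSU_hopf (s : ℝ) (X : su11) : coord 1 (adSU (hopf s) X) = coord 1 X := by
  have h : (hopf s)⁻¹ = hopf (-s) := by
    rw [inv_eq_iff_mul_eq_one, ← hopf_add, add_neg_cancel, hopf_zero]
  have e := Real.cosh_sq_sub_sinh_sq s
  rw [coord_one (adSU (hopf s) X)]
  change (((hopf s).mat * (X : Matrix (Fin 2) (Fin 2) ℂ) * ((hopf s)⁻¹).mat) 0 1).re = _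
  rw [h, su11_coe_eq X]
  simp [hopf, -Complex.ofReal_sinh, -Complex.ofReal_cosh]
  linear_combination (coord 1 X) * e

lemma isReductiveDecomposition_SU11R {nu : ℝ} (hn : nu ≠ 0) (mu t : ℝ) :
    IsReductiveDecomposition expSUR adSUR hSub (mSub mu nu t) where
  compl := by
    constructor
    · rw [Submodule.disjoint_def]
      intro U hh hm
      rw [mem_hSub] at hh
      rw [mem_mSub hn] at hm
      obtain ⟨h0, h1, h2⟩ := hh
      rw [h1] at hm
      have h3 : U.2 = 0 := by linarith
      refine Prod.ext (su11_ext ?_ ?_ ?_) h3 <;> simp [h0, h1, h2, h3]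
    · rw [codisjoint_iff, Submodule.eq_top_iff']
      intro U
      -- The linear form defining `𝔪` takes the value `2` on `X₁ + D`, hence the division by `2` in
      -- the projection to `𝔥`.
      set k := ((2 - (mu / nu + t / nu)) * coord 1 U.1 + (mu / nu + t / nu) * U.2) / 2 with hk
      refine Submodule.mem_sup.2 ⟨k • (B 1, 1), ?_, U - k • (B 1, 1), ?_, by abel⟩
      · rw [mem_hSub]; simp
      · rw [mem_mSub hn]
        simp
        rw [hk]
        ring
  isotropy U := by
    rw [mem_hSub]
    constructor
    · rintro ⟨h0, h1, h2⟩ s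
      rw [MulAction.mem_stabilizer_iff, smul_o_eq_iff]
      have e : (s • U).1 = (s * U.2) • B 1 := by
        apply su11_ext <;> simp [h0, h1, h2]
      change expSU (s • U).1 = hopf (-(s * U.2))
      rw [e, expSU_smul_B_one]
    · exact fundamental_eq_zero_of_stabilizer
  invariant a ha U hU := by
    rw [MulAction.mem_stabilizer_iff, smul_o_eq_iff] at ha
    rw [mem_mSub hn] at hU ⊢
    simp only [adSUR, ha, coord_one_adSU_hopf]
    exact hU

lemma isReductiveDecomposition_SU11 :
    IsReductiveDecomposition expSU adSU (⊥ : Submodule ℝ su11) ⊤ where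
  compl := isCompl_bot_top
  isotropy X := by
    rw [Submodule.mem_bot]
    constructor
    · rintro rfl s
      have h0 : expSU 0 = 1 := by
        apply SU11.ext
        change NormedSpace.exp (0 : Matrix (Fin 2) (Fin 2) ℂ) = 1
        exact NormedSpace.exp_zero
      rw [smul_zero, h0]
      exact one_mem _
    · intro h
      obtain ⟨h0, h1, h2⟩ := fundamental_eq_zero_of_stabilizer (U := (X, 0)) fun s => by
        have := h s
        rw [MulAction.mem_stabilizer_iff, SU11_smul_eq] at this
        simpa [expSUR] using this
      apply su11_ext <;> simpa
  invariant _ _ _ _ := Submodule.mem_top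

/-! ### The holonomy algebra and the induced structure -/

/-- The endomorphism of `T_o H31` exchanging `X₀` and `X₂` and annihilating `X₁`. -/
def boostEnd : Module.End ℝ (tangent o) where
  toFun v := ⟨((v : Amb).2.im * Complex.I, (v : Amb).1.im * Complex.I), by
    rw [mem_tangent, coe_o]; simp [bil]⟩
  map_add' v w := by
    apply Subtype.ext
    ext1 <;> simp <;> ring
  map_smul' c v := by
    apply Subtype.ext
    ext1 <;> simp <;> ring

lemma boostEnd_at (Z : VField) :
    boostEnd (Z.at o) = (ofComponents (coframe 2 Z) 0 (coframe 0 Z)).at o := by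
  apply Subtype.ext
  change (((Z o).2.im * Complex.I, (Z o).1.im * Complex.I) : Amb) =
    (ofComponents (coframe 2 Z) 0 (coframe 0 Z)) o
  rw [VField.apply_eq (ofComponents _ _ _), Z.apply_eq o, coe_o]
  ext1 <;> simp [rightMul, pauli]

/-- Extension by constant frame components; it follows that an endomorphism of `T_o` is determined
by its values on vector fields at `o`. -/
lemma exists_at_o_eq (v : tangent o) : ∃ X : VField, X.at o = v := by
  refine ⟨ofComponents (algebraMap ℝ SmoothFun (v : Amb).1.im)
    (algebraMap ℝ SmoothFun (v : Amb).2.re) (algebraMap ℝ SmoothFun (v : Amb).2.im), ?_⟩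
  apply Subtype.ext
  change ofComponents _ _ _ o = (v : Amb)
  have hv := v.2
  rw [mem_tangent, coe_o] at hv
  simp [bil] at hv
  rw [VField.apply_eq (ofComponents _ _ _), coe_o]
  ext1 <;> apply Complex.ext <;> simp [rightMul, pauli, hv]

lemma end_eq_of_at {U V : Module.End ℝ (tangent o)}
    (h : ∀ Z : VField, U (Z.at o) = V (Z.at o)) : U = V := by
  refine LinearMap.ext fun v => ?_
  obtain ⟨Z, rfl⟩ := exists_at_o_eq v
  exact h Z

lemma boostEnd_frame_zero_ne_zero : boostEnd ((frame 0).at o) ≠ 0 := by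
  intro h
  rw [boostEnd_at] at h
  have h2 := ((VField.at_o_eq_iff _ 0).1 h).2.2
  simp at h2

lemma curv_at_o (r q : ℝ) (X Y Z : VField) :
    (curv ((leviCivita r).subTensor (homTensor r q)) X Y Z).at o =
      (-2 * (r + q - 2) * (coframe 2 X o * coframe 0 Y o - coframe 0 X o * coframe 2 Y o)) •
        boostEnd (Z.at o) := by
  rw [boostEnd_at]
  refine (VField.at_o_eq_iff _
    ((-2 * (r + q - 2) * (coframe 2 X o * coframe 0 Y o - coframe 0 X o * coframe 2 Y o)) •
      ofComponents (coframe 2 Z) 0 (coframe 0 Z))).2 ?_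
  simp [curv_subTensor]
  exact ⟨by ring, by ring⟩

lemma holonomyAlgebra_eq (r q : ℝ) :
    (holonomyAlgebra ((leviCivita r).subTensor (homTensor r q))).toSubmodule =
      Submodule.span ℝ {(r + q - 2) • boostEnd} := by
  -- Multiples of one endomorphism commute, so their span is already a Lie subalgebra.
  let N : LieSubalgebra ℝ (Module.End ℝ (tangent o)) :=
    { Submodule.span ℝ {(r + q - 2) • boostEnd} with
      lie_mem' := fun {x y} hx hy => by
        obtain ⟨a, rfl⟩ := Submodule.mem_span_singleton.1 hx
        obtain ⟨b, rfl⟩ := Submodule.mem_span_singleton.1 hy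
        rw [Ring.lie_def, smul_smul, smul_smul, smul_mul_smul_comm, smul_mul_smul_comm,
          mul_comm (b * _), sub_self]
        exact Submodule.zero_mem _ }
  apply le_antisymm
  · have h : holonomyAlgebra ((leviCivita r).subTensor (homTensor r q)) ≤ N := by
      rw [holonomyAlgebra, LieSubalgebra.lieSpan_le]
      rintro U ⟨X, Y, hU⟩
      refine Submodule.mem_span_singleton.2
        ⟨-2 * (coframe 2 X o * coframe 0 Y o - coframe 0 X o * coframe 2 Y o), ?_⟩
      refine end_eq_of_at fun Z => ?_
      rw [hU, curv_at_o, LinearMap.smul_apply, LinearMap.smul_apply, smul_smul]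
      congr 1
      ring
    exact h
  · rw [Submodule.span_le, Set.singleton_subset_iff]
    -- Here `R̃(X₀, X₂) = 2cP`; the factor `1/2` yields the generator exactly.
    refine LieSubalgebra.subset_lieSpan ⟨(1 / 2 : ℝ) • frame 0, frame 2, fun Z => ?_⟩
    rw [curv_at_o, LinearMap.smul_apply]
    congr 1
    simp
    ring

lemma lie_snd (U V : su11 × ℝ) : ⁅U, V⁆.2 = 0 := by
  change ⁅U.2, V.2⁆ = 0
  rw [Ring.lie_def, mul_comm, sub_self]

lemma lie_fst (U V : su11 × ℝ) : ⁅U, V⁆.1 = ⁅U.1, V.1⁆ := rfl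

/-- The canonical connection on fundamental vector fields. -/
lemma subTensor_nab_fundamental {r q : ℝ} (U V : su11 × ℝ)
    (hU : (2 - (r + q)) * coord 1 U.1 + (r + q) * U.2 = 0) :
    (((leviCivita r).subTensor (homTensor r q)).nab (fundamental U) (fundamental V)).at o =
      (-fundamental ⁅U, V⁆).at o := by
  obtain ⟨u0, u1, u2⟩ := fundamental_o U
  obtain ⟨v0, -, v2⟩ := fundamental_o V
  obtain ⟨w0, w1, w2⟩ := fundamental_o ⁅U, V⁆
  obtain ⟨d0, d1, d2⟩ := dirDeriv_fundamental_o (fundamental U) V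
  obtain ⟨l0, l1, l2⟩ := coord_lie U.1 V.1
  rw [VField.at_o_eq_iff, subTensor_nab]
  simp only [coframe_zero_ofComponents, coframe_one_ofComponents, coframe_two_ofComponents,
    map_neg, SmoothFun.add_apply, SmoothFun.neg_apply, SmoothFun.smul_apply, SmoothFun.mul_apply,
    u0, u1, u2, v0, v2, w0, w1, w2, d0, d1, d2, lie_fst, lie_snd, l0, l1, l2]
  refine ⟨?_, by ring, ?_⟩
  -- The boost term of the connection is weighted by the `θ¹`-value of the first field; the equation
  -- of `𝔪` for `U` matches it with the bracket.
  · linear_combination (-coord 2 V.1) * hU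
  · linear_combination (-coord 0 V.1) * hU

/-- Since `∇` is torsion-free, `S_X Y - S_Y X` is minus the torsion of `∇ - S`. Being tensorial, it
may be evaluated on any fields with the prescribed values at `o`. -/
lemma homTensor_fundamental {r q : ℝ} {U V : su11 × ℝ} {X Y : VField}
    (hU : (2 - (r + q)) * coord 1 U.1 + (r + q) * U.2 = 0)
    (hV : (2 - (r + q)) * coord 1 V.1 + (r + q) * V.2 = 0)
    (hX : X.at o = (fundamental U).at o) (hY : Y.at o = (fundamental V).at o) :
    (fundamental ⁅U, V⁆).at o = (homTensor r q X Y - homTensor r q Y X).at o := by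
  obtain ⟨u0, u1, u2⟩ := fundamental_o U
  obtain ⟨v0, v1, v2⟩ := fundamental_o V
  obtain ⟨w0, w1, w2⟩ := fundamental_o ⁅U, V⁆
  obtain ⟨x0, x1, x2⟩ := (VField.at_o_eq_iff _ _).1 hX
  obtain ⟨y0, y1, y2⟩ := (VField.at_o_eq_iff _ _).1 hY
  obtain ⟨l0, l1, l2⟩ := coord_lie U.1 V.1
  rw [VField.at_o_eq_iff]
  simp only [homTensor_apply, map_sub, coframe_zero_ofComponents, coframe_one_ofComponents,
    coframe_two_ofComponents, SmoothFun.sub_apply, SmoothFun.smul_apply, SmoothFun.mul_apply,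
    x0, x1, x2, y0, y1, y2, u0, u1, u2, v0, v1, v2, w0, w1, w2, lie_fst, lie_snd, l0, l1, l2]
  refine ⟨?_, by ring, ?_⟩
  · linear_combination (-coord 2 V.1) * hU + coord 2 U.1 * hV
  · linear_combination coord 0 U.1 * hV - coord 0 V.1 * hU

lemma fundamental_at_eq_iff (U V : su11 × ℝ) : (fundamental U).at o = (fundamental V).at o ↔
    coord 0 U.1 = coord 0 V.1 ∧ coord 1 U.1 - U.2 = coord 1 V.1 - V.2 ∧
      coord 2 U.1 = coord 2 V.1 := by
  obtain ⟨u0, u1, u2⟩ := fundamental_o U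
  obtain ⟨v0, v1, v2⟩ := fundamental_o V
  rw [VField.at_o_eq_iff, u0, u1, u2, v0, v1, v2]

/-- The last clause handles the degenerate case, where the equation of `𝔪` forces the `D`-component
to vanish and `𝔪` becomes `su(1,1)`. -/
lemma exists_fundamental_at_eq (r q : ℝ) (v : tangent o) : ∃ U : su11 × ℝ,
    (2 - (r + q)) * coord 1 U.1 + (r + q) * U.2 = 0 ∧ (fundamental U).at o = v ∧
      (r + q = 2 → U.2 = 0) := by
  obtain ⟨X, rfl⟩ := exists_at_o_eq v
  let U : su11 × ℝ := (coframe 0 X o • B 0 + ((r + q) / 2 * coframe 1 X o) • B 1 +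
    coframe 2 X o • B 2, -((2 - (r + q)) / 2 * coframe 1 X o))
  obtain ⟨u0, u1, u2⟩ := fundamental_o U
  refine ⟨U, by simp [U]; ring, ?_, fun h => by simp [U, h]⟩
  rw [VField.at_o_eq_iff, u0, u1, u2]
  simp [U]
  ring

lemma isInducedBy_SU11R {mu nu t : ℝ} (hn : nu ≠ 0) (ht : t ≠ 2 * nu - mu) :
    IsInducedBy expSUR hSub (mSub mu nu t) (leviCivita (mu / nu))
      (homTensor (mu / nu) (t / nu)) := by
  have hc : mu / nu + t / nu - 2 ≠ 0 := by
    intro h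
    field_simp at h
    exact ht (by linarith)
  have hm (U : mSub mu nu t) := (mem_mSub hn).1 U.2
  have hK (V : hSub) : (fundamental V).at o = (0 : VField).at o := by
    obtain ⟨h0, h1, h2⟩ := mem_hSub.1 V.2
    have := (fundamental_at_eq_iff V 0).2 (by simp [h0, h1, h2])
    rwa [map_zero] at this
  have hKadd (V : hSub) (W : mSub mu nu t) :
      (fundamental ((V : su11 × ℝ) + W)).at o = (fundamental W).at o := by
    have h : (fundamental ((V : su11 × ℝ) + W)).at o =
        (fundamental V).at o + (fundamental W).at o := by rw [map_add]; rfl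
    rw [h, hK]
    exact zero_add _
  refine ⟨fundamental, isFundamental_expSUR, ?_, ?_,
    -- From `[X₁ + D, X₀] = -2X₂` and `[X₁ + D, X₂] = -2X₀`, the isotropy action of `u(X₁ + D)` is
    -- `-2uP`; the multiplier `u` is read off as the `D`-component.
    (LinearMap.toSpanSingleton ℝ _ ((-2 : ℝ) • boostEnd)).comp
      ((LinearMap.snd ℝ su11 ℝ).comp hSub.subtype), ?_, ?_, ?_, ?_, ?_⟩
  · intro v
    obtain ⟨U, hU, rfl, -⟩ := exists_fundamental_at_eq (mu / nu) (t / nu) v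
    refine ⟨⟨U, (mem_mSub hn).2 hU⟩, rfl, ?_⟩
    intro V hV
    obtain ⟨e0, e1, e2⟩ := (fundamental_at_eq_iff V U).1 hV
    have hV' := hm V
    apply Subtype.ext
    have e3 : (V : su11 × ℝ).2 = U.2 := by
      linear_combination (1 / 2) * (hV' - hU - (2 - (mu / nu + t / nu)) * e1)
    exact Prod.ext (su11_ext e0 (by linarith) e2) e3
  · intro X Y W V h
    rw [subTensor_nab_fundamental _ _ (hm X), h]
    exact congrArg Neg.neg (hKadd V W)
  · intro U V h
    have h1 : (U : su11 × ℝ).2 = (V : su11 × ℝ).2 := by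
      have h' : (U : su11 × ℝ).2 • ((-2 : ℝ) • boostEnd ((frame 0).at o)) =
        (V : su11 × ℝ).2 • ((-2 : ℝ) • boostEnd ((frame 0).at o)) := LinearMap.congr_fun h _
      exact smul_left_injective ℝ (smul_ne_zero (by norm_num) boostEnd_frame_zero_ne_zero) h'
    obtain ⟨u0, u1, u2⟩ := mem_hSub.1 U.2
    obtain ⟨v0, v1, v2⟩ := mem_hSub.1 V.2
    exact Subtype.ext (Prod.ext (su11_ext (by rw [u0, v0]) (by rw [u1, v1, h1])
      (by rw [u2, v2])) h1)
  -- Here `t ≠ 2ν - μ` is essential: the holonomy algebra is the full line spanned by `P`, which is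
  -- the range of `κ`.
  · rw [holonomyAlgebra_eq, Submodule.span_singleton_smul_eq (isUnit_iff_ne_zero.2 hc)]
    ext E
    rw [Submodule.mem_span_singleton]
    constructor
    · rintro ⟨U, rfl⟩
      exact ⟨(U : su11 × ℝ).2 * -2, by
        rw [mul_smul]; rfl⟩
    · rintro ⟨k, rfl⟩
      refine ⟨⟨(-(k / 2)) • (B 1, 1), mem_hSub.2 (by simp)⟩, ?_⟩
      simp [smul_smul]
  · intro U V
    obtain ⟨u0, u1, u2⟩ := mem_hSub.1 U.2
    obtain ⟨v0, v1, v2⟩ := mem_hSub.1 V.2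
    obtain ⟨l0, l1, l2⟩ := coord_lie (U : su11 × ℝ).1 (V : su11 × ℝ).1
    refine ⟨0, Prod.ext (su11_ext ?_ ?_ ?_) (lie_snd _ _).symm, ?_⟩
    · simp [l0, u2, v2]
    · simp [l1, u2, v2, u0, v0]
    · simp [l2, u0, v0]
    · simp [smul_smul]
      rw [mul_comm]
      exact LinearMap.ext fun v => (sub_self (_ : tangent o)).symm
  · intro U X
    obtain ⟨u0, u1, u2⟩ := mem_hSub.1 U.2
    obtain ⟨l0, l1, l2⟩ := coord_lie (U : su11 × ℝ).1 (X : su11 × ℝ).1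
    obtain ⟨x0, x1, x2⟩ := fundamental_o X
    obtain ⟨w0, w1, w2⟩ := fundamental_o ⁅(U : su11 × ℝ), (X : su11 × ℝ)⁆
    refine ⟨⟨⁅(U : su11 × ℝ), (X : su11 × ℝ)⁆, (mem_mSub hn).2 ?_⟩, rfl, ?_⟩
    · rw [lie_fst, lie_snd, l1, u0, u2]
      ring
    · have e : ((LinearMap.toSpanSingleton ℝ (Module.End ℝ (tangent o)) ((-2 : ℝ) • boostEnd)).comp
          ((LinearMap.snd ℝ su11 ℝ).comp hSub.subtype)) U ((fundamental X).at o) =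
          (((U : su11 × ℝ).2 * -2) • ofComponents (coframe 2 (fundamental X)) 0
            (coframe 0 (fundamental X))).at o := by
        simp only [LinearMap.comp_apply, LinearMap.toSpanSingleton_apply, LinearMap.smul_apply,
          boostEnd_at, smul_smul]
        rfl
      rw [e, VField.at_o_eq_iff]
      simp only [coframe_smul, coframe_zero_ofComponents, coframe_one_ofComponents,
        coframe_two_ofComponents, SmoothFun.smul_apply, SmoothFun.zero_apply,
        w0, w1, w2, x0, x2, lie_fst, lie_snd, l0, l1, l2, u0, u1, u2]
      exact ⟨by ring, by ring, by ring⟩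
  · intro X Y
    obtain ⟨l0, l1, l2⟩ := coord_lie (X : su11 × ℝ).1 (Y : su11 × ℝ).1
    -- The `𝔥`-component of the bracket, by the same projection as before; brackets have no
    -- `D`-component because the factor `ℝ` is abelian.
    set k := (2 - (mu / nu + t / nu)) * coord 1 ⁅(X : su11 × ℝ).1, (Y : su11 × ℝ).1⁆ / 2 with hk
    have hV : k • ((B 1, 1) : su11 × ℝ) ∈ hSub := mem_hSub.2 (by simp)
    have hW : ⁅(X : su11 × ℝ), (Y : su11 × ℝ)⁆ - k • ((B 1, 1) : su11 × ℝ) ∈ mSub mu nu t := by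
      rw [mem_mSub hn]
      simp only [Prod.fst_sub, Prod.snd_sub, Prod.smul_fst, Prod.smul_snd, map_sub, map_smul,
        coord_B, lie_fst, lie_snd, smul_eq_mul, if_true]
      rw [hk]
      ring
    have hadd : ⁅(X : su11 × ℝ), (Y : su11 × ℝ)⁆ = k • ((B 1, 1) : su11 × ℝ) +
        (⁅(X : su11 × ℝ), (Y : su11 × ℝ)⁆ - k • ((B 1, 1) : su11 × ℝ)) := by abel
    refine ⟨⟨_, hV⟩, ⟨_, hW⟩, hadd, fun X' Y' hX hY => ⟨?_, fun Z => ?_⟩⟩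
    -- Fundamental fields of `𝔥` vanish at `o`, so the `𝔪`-part of the bracket has the same value
    -- there as the whole bracket.
    · rw [← hKadd ⟨_, hV⟩ ⟨_, hW⟩, ← homTensor_fundamental (hm X) (hm Y) hX hY]
      exact congrArg (fun U => (fundamental U).at o) hadd.symm
    · obtain ⟨u0, u1, u2⟩ := fundamental_o X
      obtain ⟨v0, v1, v2⟩ := fundamental_o Y
      obtain ⟨x0, x1, x2⟩ := (VField.at_o_eq_iff _ _).1 hX
      obtain ⟨y0, y1, y2⟩ := (VField.at_o_eq_iff _ _).1 hY
      rw [curv_at_o, x0, x2, y0, y2, u0, u2, v0, v2]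
      refine Eq.trans ?_ (neg_smul _ _)
      simp only [LinearMap.comp_apply, LinearMap.toSpanSingleton_apply, LinearMap.smul_apply,
        smul_smul]
      congr 1
      simp [hk, l1]
      ring

/-- Now `c = 0`: the connection `∇ - S` is flat, the holonomy algebra is zero, and every `(X, 0)`
satisfies the equation of `𝔪`, so the computations for the larger group apply with `κ = 0`. -/
lemma isInducedBy_SU11 {r q : ℝ} (h : r + q = 2) :
    IsInducedBy expSU ⊥ ⊤ (leviCivita r) (homTensor r q) := by
  have h0 (X : su11) : (2 - (r + q)) * coord 1 ((X, 0) : su11 × ℝ).1 +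
      (r + q) * ((X, 0) : su11 × ℝ).2 = 0 := by rw [h]; simp
  have hl (X Y : su11) : ⁅((X, 0) : su11 × ℝ), ((Y, 0) : su11 × ℝ)⁆ = (⁅X, Y⁆, 0) :=
    Prod.ext rfl (lie_snd _ _)
  refine ⟨fun X => fundamental (X, 0), isFundamental_expSU, ?_, ?_, 0, ?_, ?_, ?_, ?_, ?_⟩
  · intro v
    obtain ⟨U, -, rfl, hU⟩ := exists_fundamental_at_eq r q v
    have e : ((U.1, 0) : su11 × ℝ) = U := Prod.ext rfl (hU h).symm
    refine ⟨⟨U.1, Submodule.mem_top⟩, by simp only [e], fun V hV => ?_⟩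
    obtain ⟨e0, e1, e2⟩ := (fundamental_at_eq_iff _ U).1 hV
    rw [hU h] at e1
    exact Subtype.ext (su11_ext e0 (by simpa using e1) e2)
  · intro X Y W V hV
    rw [subTensor_nab_fundamental _ _ (h0 X), hl, hV, (Submodule.mem_bot ℝ).1 V.2, zero_add]
    rfl
  · intro U V _
    exact Subsingleton.elim _ _
  · rw [holonomyAlgebra_eq, h]
    simp
  · intro U V
    exact ⟨0, by simp [(Submodule.mem_bot ℝ).1 U.2],
      LinearMap.ext fun v => (sub_self (0 : tangent o)).symm⟩
  · intro U X
    refine ⟨0, by simp [(Submodule.mem_bot ℝ).1 U.2], ?_⟩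
    change (fundamental 0).at o = 0
    rw [map_zero]
    rfl
  · intro X Y
    refine ⟨0, ⟨⁅(X : su11), (Y : su11)⁆, Submodule.mem_top⟩, by simp,
      fun X' Y' hX hY => ⟨?_, fun Z => ?_⟩⟩
    · rw [← homTensor_fundamental (h0 X) (h0 Y) hX hY, hl]
    · rw [curv_at_o, h]
      simp

end AdS3

end

/-! ### The theorem, assembled from the explicit models. -/

open AdS3 in
theorem mainTheorem9 (lam mu nu t : ℝ) (hmu : 0 < mu) (hnu : 0 < nu) (h1 : -lam = nu)
    (h2 : nu ≠ mu) :
    -- `g_{λμν}` is Lorentzian; its Levi-Civita connection `D` and the `(1,2)`-tensor field `S`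
    -- associated with `S_μ(t)` exist and are unique
    IsLorentzian (kkMetric lam mu nu) ∧
    (∃! D : AffineConnection, IsLeviCivita (kkMetric lam mu nu) D) ∧
    (∃! S : Tensor12, IsAssociated (kkMetric lam mu nu) (Smu mu t) S) ∧
    ∀ (D : AffineConnection) (S : Tensor12), IsLeviCivita (kkMetric lam mu nu) D →
      IsAssociated (kkMetric lam mu nu) (Smu mu t) S →
      IsParaSasakian (kkMetric lam mu nu) D (phi1 lam mu nu) (xi1 lam mu nu) (eta1 lam mu nu)
        (algebraMap ℝ SmoothFun (-(Real.sqrt mu / nu))) ∧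
      IsHomogeneousAlmostParacontactMetric (kkMetric lam mu nu) D S (phi1 lam mu nu)
        (xi1 lam mu nu) (eta1 lam mu nu) ∧
      (t ≠ 2 * nu - mu →
        IsTransitiveEffectiveIsometric SU11R (kkMetric lam mu nu) ∧
        (∀ a : SU11R, PreservesTensors S (phi1 lam mu nu) (xi1 lam mu nu) (eta1 lam mu nu)
          (MulAction.toPerm a)) ∧
        IsReductiveDecomposition expSUR adSUR hSub (mSub mu nu t) ∧
        IsInducedBy expSUR hSub (mSub mu nu t) D S) ∧
      (t = 2 * nu - mu →
        IsTransitiveEffectiveIsometric SU11 (kkMetric lam mu nu) ∧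
        (∀ a : SU11, PreservesTensors S (phi1 lam mu nu) (xi1 lam mu nu) (eta1 lam mu nu)
          (MulAction.toPerm a)) ∧
        IsReductiveDecomposition expSU adSU ⊥ ⊤ ∧
        IsInducedBy expSU ⊥ ⊤ D S) := by
  obtain rfl : lam = -nu := by linarith
  have hl : -nu ≠ 0 := (neg_lt_zero.2 hnu).ne
  have hD := isLeviCivita_leviCivita (mu := mu) hnu.ne'
  have hS := isAssociated_homTensor (mu := mu) hnu.ne' t
  refine ⟨isLorentzian_kkMetric (neg_lt_zero.2 hnu) hmu hnu,
    ⟨_, hD, fun D' h => h.unique hl hmu.ne' hnu.ne' hD⟩,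
    ⟨_, hS, fun S' h => h.unique hl hmu.ne' hnu.ne' hS⟩, fun D S hD' hS' => ?_⟩
  -- By uniqueness the given connection and tensor are the explicit ones, for which everything has
  -- been computed.
  obtain rfl := hD'.unique hl hmu.ne' hnu.ne' hD
  obtain rfl := hS'.unique hl hmu.ne' hnu.ne' hS
  refine ⟨isParaSasakian hmu hnu, isHomogeneousAlmostParacontactMetric hmu hnu t,
    fun ht => ⟨isTransitiveEffectiveIsometric_SU11R mu nu, preservesTensors_toPerm hnu mu _ _,
      isReductiveDecomposition_SU11R hnu.ne' mu t, isInducedBy_SU11R hnu.ne' ht⟩,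
    fun ht => ⟨isTransitiveEffectiveIsometric_SU11 mu nu, fun a => ?_,
      isReductiveDecomposition_SU11, isInducedBy_SU11 ?_⟩⟩
  · rw [toPerm_SU11_eq]
    exact preservesTensors_toPerm hnu mu _ _ _
  · rw [ht]
    field_simp
    ring
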